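/- For $\beta>\pi$ let $V(\theta)=1/\sin^2\theta$ for $0<\theta<\pi/2$, $V(\theta)=1$ for $\pi/2\le\theta\le\beta-\pi/2$ and $V(\theta)=1/\sin^2(\beta-\theta)$ for $\beta-\pi/2<\theta<\beta$. For $c>0$ consider the boundary value problem $$-\psi''(\theta)=c\,V(\theta)\psi(\theta)\ \text{ on } (0,\beta/2),\qquad \psi(0)=\psi'(\beta/2)=0. \tag{1}$$ A positive solution of (1) is a function $\psi$, continuous on $[0,\beta/2]$, positive and twice differentiable on $(0,\beta/2)$, which satisfies the equation pointwise, has $\psi(0)=0$, and has one-sided derivative $0$ at $\beta/2$. We say that $\psi\in H^1_0(0,\beta)$ if its even reflection about $\beta/2$ belongs to $H^1_0(0,\beta)$. Let $\beta_{cr}$ be the unique solution in $(\pi,2\pi)$ of $\tan\big(\frac{\beta_{cr}-\pi}{4}\big)=4\big(\Gamma(\tfrac34)/\Gamma(\tfrac14)\big)^2$, and let $$F(a,b,c;z)=\frac{\Gamma(c)}{\Gamma(a)\Gamma(b)}\sum_{n\ge0}\frac{\Gamma(a+n)\Gamma(b+n)}{\Gamma(c+n)}\frac{z^n}{n!}$$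 be the hypergeometric function. Consider for $0<c\le\frac14$ the equation $$\sqrt c\,\tan\Big(\sqrt c\,\frac{\beta-\pi}{2}\Big)=2\left(\frac{\Gamma\big(\frac{3+\sqrt{1-4c}}{4}\big)}{\Gamma\big(\frac{1+\sqrt{1-4c}}{4}\big)}\right)^2,\qquad \sqrt c\,\frac{\beta-\pi}{2}<\frac{\pi}{2} \tag{2}$$ (the inequality, which selects the principal branch of the tangent, is automatic if $\beta<3\pi$, in particular if $\beta\le 2\pi$). (i) Let $\beta>\beta_{cr}$. For every $c>0$, problem (1) has a positive solution in $H^1_0(0,\beta)$ if and only if $c$ solves (2). Moreover, $c$ is the largest positive constant for which (1) has a positive solution if and only if $c$ solves (2). If $c$ solves (2), let $\alpha$ be the largest solution of $\alpha(1-\alpha)=c$; then $$\psi(\theta)=\begin{cases}\dfrac{\sqrt2\cos\big(\sqrt c(\beta-\pi)/2\big)\sin^{\alpha}(\theta/2)\cos^{1-\alpha}(\theta/2)}{F(\frac12,\frac12,\alpha+\frac12;\frac12)}\,F\big(\tfrac12,\tfrac12,\alpha+\tfrac12;\sin^2(\theta/2)\big), & 0\le\theta\le\frac\pi2,\\[2mm]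 \cos\big(\sqrt c(\frac\beta2-\theta)\big), & \frac\pi2<\theta\le\frac\beta2,\end{cases}$$ is a positive solution of (1), it belongs to $H^1_0(0,\beta)$, and every positive solution of (1) is a positive constant multiple of it. (ii) Let $\pi<\beta\le\beta_{cr}$. The largest $c>0$ for which (1) has a positive solution is $c=\frac14$. For $\beta=\beta_{cr}$ and $c=\frac14$, $$\psi(\theta)=\begin{cases}\dfrac{\cos\big(\frac{\beta_{cr}-\pi}{4}\big)\sin^{1/2}\theta}{F(\frac12,\frac12,1;\frac12)}\,F\big(\tfrac12,\tfrac12,1;\sin^2(\theta/2)\big), & 0\le\theta\le\frac\pi2,\\[2mm] \cos\big(\frac12(\frac{\beta_{cr}}2-\theta)\big), & \frac\pi2<\theta\le\frac{\beta_{cr}}2,\end{cases}$$ is a positive solution of (1), and every positive solution is a positive constant multiple of it. -/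

import Mathlib

open Real Set MeasureTheory
open scoped ContDiff

namespace SectorHardy

/-- The potential `V` on `(0, β)`, for `β > π`. -/
noncomputable def V (β θ : ℝ) : ℝ :=
  if θ < π / 2 then 1 / sin θ ^ 2
  else if θ ≤ β - π / 2 then 1
  else 1 / sin (β - θ) ^ 2

/-- `ψ` is a positive classical solution of `-ψ'' = c V ψ` on `(0, β/2)` with
`ψ(0) = 0` and `ψ'(β/2) = 0`. The function `ψ` is only looked at on `[0, β/2]`; at the right
endpoint the derivative is the one-sided one. -/
structure IsPositiveSolution (β c : ℝ) (ψ : ℝ → ℝ) : Prop where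
  continuousOn : ContinuousOn ψ (Icc 0 (β / 2))
  pos : ∀ θ ∈ Ioo 0 (β / 2), 0 < ψ θ
  differentiableAt : ∀ θ ∈ Ioo 0 (β / 2), DifferentiableAt ℝ ψ θ
  ode : ∀ θ ∈ Ioo 0 (β / 2), HasDerivAt (deriv ψ) (-(c * V β θ * ψ θ)) θ
  left_bc : ψ 0 = 0
  right_bc : HasDerivWithinAt ψ 0 (Icc 0 (β / 2)) (β / 2)

/-- The even reflection about `β/2` of a function on `[0, β/2]`, a function on `[0, β]`. -/
noncomputable def reflect (β : ℝ) (ψ : ℝ → ℝ) (θ : ℝ) : ℝ :=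
  if θ ≤ β / 2 then ψ θ else ψ (β - θ)

/-- `g` is the weak derivative of `f` on `(a, b)`. -/
def HasWeakDerivOn (a b : ℝ) (f g : ℝ → ℝ) : Prop :=
  ∀ φ : ℝ → ℝ, ContDiff ℝ ∞ φ → HasCompactSupport φ → tsupport φ ⊆ Ioo a b →
    ∫ x in Ioo a b, f x * deriv φ x = -∫ x in Ioo a b, g x * φ x

/-- The continuous function `f` on `[a, b]` belongs to the Sobolev space `H¹₀(a, b)`: it is
square integrable, has a square integrable weak derivative, and vanishes at the endpoints. -/
def MemH10 (a b : ℝ) (f : ℝ → ℝ) : Prop :=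
  ContinuousOn f (Icc a b) ∧ f a = 0 ∧ f b = 0 ∧
    MemLp f 2 (volume.restrict (Ioo a b)) ∧
    ∃ g : ℝ → ℝ, MemLp g 2 (volume.restrict (Ioo a b)) ∧ HasWeakDerivOn a b f g

/-- The algebraic equation for `c`, without restriction on the branch of the tangent. The bound
`c ≤ 1/4` is what makes the square root `√(1 - 4c)` meaningful. -/
def AlgEq (β c : ℝ) : Prop :=
  0 < c ∧ c ≤ 1 / 4 ∧
    √c * tan (√c * ((β - π) / 2)) =
      2 * (Gamma ((3 + √(1 - 4 * c)) / 4) / Gamma ((1 + √(1 - 4 * c)) / 4)) ^ 2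

/-- `c` solves the algebraic equation on the principal branch of the tangent. -/
def SolvesAlg (β c : ℝ) : Prop :=
  AlgEq β c ∧ √c * ((β - π) / 2) < π / 2

/-- For `β < 3π`, in particular for `β ≤ 2π`, the branch condition is automatic. -/
theorem solvesAlg_iff_of_lt {β c : ℝ} (hβ : β < 3 * π) : SolvesAlg β c ↔ AlgEq β c := by
  refine ⟨fun h => h.1, fun h => ⟨h, ?_⟩⟩
  have h0 : 0 < √c := Real.sqrt_pos.2 h.1
  have h1 : √c ≤ 1 / 2 := by
    rw [Real.sqrt_le_left (by norm_num)]
    have := h.2.1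
    norm_num at this ⊢
    exact this
  have hp := Real.pi_pos
  have h2 : √c * ((β - π) / 2) < √c * π := by
    apply mul_lt_mul_of_pos_left _ h0
    linarith
  nlinarith

/-- The critical angle; see `betaCr_spec`. -/
noncomputable def betaCr : ℝ :=
  π + 4 * arctan (4 * (Gamma (3 / 4) / Gamma (1 / 4)) ^ 2)

/-- `betaCr` is the unique solution in `(π, 2π)` of
`tan ((b - π) / 4) = 4 (Γ(3/4) / Γ(1/4))²`. -/
theorem betaCr_spec :
    betaCr ∈ Ioo π (2 * π) ∧
    tan ((betaCr - π) / 4) = 4 * (Gamma (3 / 4) / Gamma (1 / 4)) ^ 2 ∧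
    ∀ b ∈ Ioo π (2 * π), tan ((b - π) / 4) = 4 * (Gamma (3 / 4) / Gamma (1 / 4)) ^ 2 →
      b = betaCr := by
  have hp := Real.pi_pos
  have g3 : 0 < Gamma (3 / 4) := Real.Gamma_pos_of_pos (by norm_num)
  have g1 : 0 < Gamma (1 / 4) := Real.Gamma_pos_of_pos (by norm_num)
  have hlt : 4 * (Gamma (3 / 4) / Gamma (1 / 4)) ^ 2 < 1 := by
    have h74 : Gamma (7 / 4) ≤ 1 := by
      have := Real.convexOn_Gamma.2 (show (1 : ℝ) ∈ Ioi 0 by simp) (show (2 : ℝ) ∈ Ioi 0 by simp)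
        (show (0 : ℝ) ≤ 1 / 4 by norm_num) (show (0 : ℝ) ≤ 3 / 4 by norm_num) (by norm_num)
      simp only [smul_eq_mul, Real.Gamma_one, Real.Gamma_two] at this
      norm_num at this
      exact this
    have h34 : Gamma (7 / 4) = 3 / 4 * Gamma (3 / 4) := by
      have := Real.Gamma_add_one (s := 3 / 4) (by norm_num)
      norm_num at this
      exact this
    have hr : Gamma (1 / 4) * Gamma (3 / 4) = π / sin (π / 4) := by
      have := Real.Gamma_mul_Gamma_one_sub (1 / 4)
      rw [show (1 : ℝ) - 1 / 4 = 3 / 4 by norm_num, show π * (1 / 4) = π / 4 by ring] at this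
      exact this
    have hs : 0 < sin (π / 4) := Real.sin_pos_of_pos_of_lt_pi (by linarith) (by linarith)
    have hq : 0 ≤ Gamma (3 / 4) / Gamma (1 / 4) := by positivity
    have hh : Gamma (3 / 4) / Gamma (1 / 4) < 1 / 2 := by
      have hs2 : sin (π / 4) < 3 / 4 := by
        rw [Real.sin_pi_div_four]
        nlinarith [Real.sq_sqrt (show (0 : ℝ) ≤ 2 by norm_num), Real.sqrt_nonneg 2]
      have h4 : 4 < Gamma (1 / 4) * Gamma (3 / 4) := by
        rw [hr, lt_div_iff₀ hs]
        nlinarith [Real.pi_gt_three]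
      rw [div_lt_iff₀ g1]; nlinarith
    nlinarith
  have hpos : 0 < 4 * (Gamma (3 / 4) / Gamma (1 / 4)) ^ 2 := by positivity
  refine ⟨⟨?_, ?_⟩, ?_, ?_⟩
  · have := Real.arctan_pos.2 hpos
    unfold betaCr; linarith
  · have := Real.arctan_strictMono hlt
    rw [Real.arctan_one] at this
    unfold betaCr; linarith
  · have : (betaCr - π) / 4 = arctan (4 * (Gamma (3 / 4) / Gamma (1 / 4)) ^ 2) := by
      unfold betaCr; ring
    rw [this, Real.tan_arctan]
  · intro b hb h
    have := Real.arctan_tan (x := (b - π) / 4) (by linarith [hb.1]) (by linarith [hb.2])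
    rw [h] at this
    unfold betaCr; rw [this]; ring

/-- The exponent `α`; see `alpha_isGreatest`. -/
noncomputable def alpha (c : ℝ) : ℝ := (1 + √(1 - 4 * c)) / 2

/-- `alpha c` is the largest solution of `α (1 - α) = c`. -/
theorem alpha_isGreatest {c : ℝ} (hc : c ≤ 1 / 4) :
    IsGreatest {a : ℝ | a * (1 - a) = c} (alpha c) := by
  have hs := Real.sq_sqrt (show 0 ≤ 1 - 4 * c by linarith)
  have h0 := Real.sqrt_nonneg (1 - 4 * c)
  refine ⟨?_, ?_⟩
  · simp only [mem_ofPred_eq, alpha]; nlinarith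
  · intro a ha
    simp only [mem_ofPred_eq] at ha
    unfold alpha
    by_contra hlt
    push Not at hlt
    nlinarith

/-- The explicit solution for `β > β_cr`. -/
noncomputable def psi (β c θ : ℝ) : ℝ :=
  if θ ≤ π / 2 then
    √2 * cos (√c * (β - π) / 2) * sin (θ / 2) ^ alpha c * cos (θ / 2) ^ (1 - alpha c) /
        ordinaryHypergeometric (1 / 2 : ℝ) (1 / 2) (alpha c + 1 / 2) (1 / 2 : ℝ) *
      ordinaryHypergeometric (1 / 2 : ℝ) (1 / 2) (alpha c + 1 / 2) (sin (θ / 2) ^ 2)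
  else cos (√c * (β / 2 - θ))

/-- The explicit solution for `β = β_cr` and `c = 1/4`. -/
noncomputable def psiCr (θ : ℝ) : ℝ :=
  if θ ≤ π / 2 then
    cos ((betaCr - π) / 4) * sin θ ^ (1 / 2 : ℝ) /
        ordinaryHypergeometric (1 / 2 : ℝ) (1 / 2) 1 (1 / 2 : ℝ) *
      ordinaryHypergeometric (1 / 2 : ℝ) (1 / 2) 1 (sin (θ / 2) ^ 2)
  else cos (1 / 2 * (betaCr / 2 - θ))

end SectorHardy

/-! Near 0 the equation resembles -ψ'' = cψ/θ², whose exponents are the roots of α(1 - α) = c. For c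
> 1/4 they are not real and solutions oscillate; a Riccati argument (`le_quarter`) excludes
positivity. For 0 < c ≤ 1/4, `regSol` with the larger root is an explicit solution on (0, π), of
size O(√θ) at 0. On [π/2, β/2] the Neumann condition forces a multiple of cos(√c(β/2 - θ)). The
algebraic equation says that the logarithmic derivatives of these two solutions agree at π/2.

The Gamma quotient enters through `regSlope_eq_gammaQuot`: the slope of `regSol` and the Gamma
expression satisfy the same recursion R(a) R(a+1) = a² with 0 < R(a) ≤ a, which has only one
solution.

Square integrability of ψ' forces ψ to be o(√θ) along some sequence, and so a multiple of `regSol`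
on (0, π/2] (`deriv_pi_div_two_of_memH10`). Conversely, for β > β_cr the root c is below 1/4, hence
α > 1/2 and the glued function lies in H¹₀. It also yields the largest c: against a solution with ψ²
≤ Cθ, a positive solution for a larger constant would have a quotient diverging logarithmically to
-∞ at 0 (`le_of_sq_le`). For β ≤ β_cr the value 1/4 is attained by adding a nonnegative multiple of
the second solution at c = 1/4, which also vanishes at 0. -/

namespace SectorHardy

open Filter Topology

/-! ### Hypergeometric series and contiguous relations -/

/-- A power series with bounded coefficients is differentiable term by term on the unit disc. -/
theorem hasDerivAt_tsum_pow {f : ℕ → ℝ} (hf : ∀ n, |f n| ≤ 1) {z : ℝ} (hz : |z| < 1) :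
    Summable (fun n => f n * z ^ n) ∧ Summable (fun n : ℕ => f n * (n * z ^ (n - 1))) ∧
    HasDerivAt (fun y => ∑' n, f n * y ^ n) (∑' n : ℕ, f n * (n * z ^ (n - 1))) z := by
  obtain ⟨r, hzr, hr1⟩ := exists_between hz
  have hr0 : 0 ≤ r := (abs_nonneg z).trans hzr.le
  have hu : Summable (fun n : ℕ => (n : ℝ) * r ^ (n - 1)) := by
    rw [← summable_nat_add_iff 1]
    have h1 := summable_pow_mul_geometric_of_norm_lt_one 1
      (show ‖r‖ < 1 by rwa [Real.norm_of_nonneg hr0])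
    have h0 := summable_geometric_of_lt_one hr0 hr1
    refine (h1.add h0).congr fun n => ?_
    simp; ring
  have hb : ∀ n : ℕ, ∀ y ∈ Ioo (-r) r, ‖f n * (n * y ^ (n - 1))‖ ≤ n * r ^ (n - 1) := by
    intro n y hy
    rw [norm_mul, norm_mul, norm_pow, Real.norm_eq_abs, Real.norm_eq_abs, Nat.abs_cast]
    have hy' : ‖y‖ ≤ r := (abs_lt.2 hy).le
    calc _ ≤ 1 * ((n : ℝ) * r ^ (n - 1)) := by gcongr; exact hf n
      _ = _ := one_mul _
  have hz' : z ∈ Ioo (-r) r := abs_lt.1 hzr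
  have hs : Summable (fun n => f n * z ^ n) := by
    refine Summable.of_norm_bounded (summable_geometric_of_lt_one (abs_nonneg z) hz) fun n => ?_
    rw [norm_mul, norm_pow, Real.norm_eq_abs, Real.norm_eq_abs]
    exact mul_le_of_le_one_left (by positivity) (hf n)
  refine ⟨hs, Summable.of_norm_bounded hu fun n => hb n z hz', ?_⟩
  exact hasDerivAt_tsum_of_isPreconnected hu isOpen_Ioo isPreconnected_Ioo
    (fun n y _ => (hasDerivAt_pow n y).const_mul (f n)) hb hz' hs hz'

/-- The coefficients of `hyp a`. -/
noncomputable def hypCoeff (a : ℝ) (n : ℕ) : ℝ :=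
  ordinaryHypergeometricCoefficient (1 / 2 : ℝ) (1 / 2) (a + 1 / 2) n

/-- The hypergeometric functions with first two parameters `1/2`. -/
noncomputable def hyp (a z : ℝ) : ℝ := ordinaryHypergeometric (1 / 2 : ℝ) (1 / 2) (a + 1 / 2) z

theorem hyp_eq_tsum (a : ℝ) : hyp a = fun z => ∑' n, hypCoeff a n * z ^ n := by
  ext z
  simp only [hyp, ordinaryHypergeometric_eq_tsum, smul_eq_mul, hypCoeff,
    ordinaryHypergeometricCoefficient]

theorem hypCoeff_zero (a : ℝ) : hypCoeff a 0 = 1 := by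
  simp [hypCoeff, ordinaryHypergeometricCoefficient]

theorem hypCoeff_succ {a : ℝ} (ha : 0 < a) (n : ℕ) :
    hypCoeff a (n + 1) = hypCoeff a n * ((n + 1 / 2) ^ 2 / ((n + 1) * (a + 1 / 2 + n))) := by
  have h1 : (ascPochhammer ℝ n).eval (a + 1 / 2) ≠ 0 :=
    (ascPochhammer_pos n _ (by linarith)).ne'
  have h2 : a + 1 / 2 + (n : ℝ) ≠ 0 := by positivity
  have h3 : (n.factorial : ℝ) ≠ 0 := by positivity
  have h4 : (n : ℝ) + 1 ≠ 0 := by positivity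
  simp only [hypCoeff, ordinaryHypergeometricCoefficient, ascPochhammer_succ_eval,
    Nat.factorial_succ, Nat.cast_mul, Nat.cast_add, Nat.cast_one]
  field_simp
  ring

theorem hypCoeff_pos {a : ℝ} (ha : 0 < a) (n : ℕ) : 0 < hypCoeff a n := by
  induction n with
  | zero => simp [hypCoeff_zero]
  | succ n ih => rw [hypCoeff_succ ha]; positivity

/-- The bound compares the series with that of -log(1 - z)/z and so controls its singularity at z =
1. The induction step reduces to (n + 1/2)²(n + 2) ≤ (n + 1)³. -/
theorem hypCoeff_le {a : ℝ} (ha : 1 / 2 ≤ a) (n : ℕ) : hypCoeff a n ≤ 1 / (n + 1) := by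
  have ha0 : 0 < a := by linarith
  induction n with
  | zero => simp [hypCoeff_zero]
  | succ n ih =>
    rw [hypCoeff_succ ha0]
    have hn : (0 : ℝ) ≤ n := n.cast_nonneg
    calc _ ≤ 1 / ((n : ℝ) + 1) * ((n + 1 / 2) ^ 2 / ((n + 1) * (1 + n))) := by
          gcongr
          linarith
      _ ≤ _ := by
          push_cast
          rw [div_mul_div_comm, div_le_div_iff₀ (by positivity) (by positivity)]
          nlinarith [mul_nonneg hn hn]

theorem abs_hypCoeff_le_one {a : ℝ} (ha : 1 / 2 ≤ a) (n : ℕ) : |hypCoeff a n| ≤ 1 := by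
  rw [abs_of_pos (hypCoeff_pos (by linarith) n)]
  refine (hypCoeff_le ha n).trans ?_
  rw [div_le_one (by positivity)]
  linarith [n.cast_nonneg (α := ℝ)]

/-- With b = a + 1/2, the quotient of the Pochhammer symbols (b)ₙ and (b+1)ₙ is b/(b + n). Both
contiguous relations come from this identity. -/
theorem hypCoeff_add_one {a : ℝ} (ha : 0 < a) (n : ℕ) :
    (a + 1 / 2 + n) * hypCoeff (a + 1) n = (a + 1 / 2) * hypCoeff a n := by
  induction n with
  | zero => simp [hypCoeff_zero]
  | succ n ih =>
    rw [hypCoeff_succ ha, hypCoeff_succ (by linarith)]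
    have h2 : a + 1 / 2 + (n : ℝ) ≠ 0 := by positivity
    have h3 : a + 1 + 1 / 2 + (n : ℝ) ≠ 0 := by positivity
    have h4 : (n : ℝ) + 1 ≠ 0 := by positivity
    calc _ = (a + 1 / 2 + n) * hypCoeff (a + 1) n *
          ((n + 1 / 2) ^ 2 / ((n + 1) * (a + 1 / 2 + n))) := by
            push_cast; field_simp; ring
      _ = _ := by rw [ih]; ring

theorem hypCoeff_add_one_le {a : ℝ} (ha : 0 < a) (n : ℕ) : hypCoeff (a + 1) n ≤ hypCoeff a n := by
  have h := hypCoeff_add_one ha n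
  have hp := hypCoeff_pos (show 0 < a + 1 by linarith) n
  have hn : (0 : ℝ) ≤ n := n.cast_nonneg
  have : (a + 1 / 2) * hypCoeff (a + 1) n ≤ (a + 1 / 2) * hypCoeff a n := by
    rw [← h]
    exact mul_le_mul_of_nonneg_right (by linarith) hp.le
  exact le_of_mul_le_mul_left this (by linarith)

theorem hasSum_hyp {a : ℝ} (ha : 1 / 2 ≤ a) {z : ℝ} (hz : |z| < 1) :
    HasSum (fun n => hypCoeff a n * z ^ n) (hyp a z) := by
  rw [hyp_eq_tsum]
  exact (hasDerivAt_tsum_pow (abs_hypCoeff_le_one ha) hz).1.hasSum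

theorem hasSum_deriv_hyp {a : ℝ} (ha : 1 / 2 ≤ a) {z : ℝ} (hz : |z| < 1) :
    HasDerivAt (hyp a) (deriv (hyp a) z) z ∧
    HasSum (fun n : ℕ => hypCoeff a n * (n * z ^ (n - 1))) (deriv (hyp a) z) := by
  obtain ⟨_, h2, h3⟩ := hasDerivAt_tsum_pow (abs_hypCoeff_le_one ha) hz
  rw [← hyp_eq_tsum] at h3
  rw [h3.deriv]
  exact ⟨h3, h2.hasSum⟩

theorem hasDerivAt_hyp {a : ℝ} (ha : 1 / 2 ≤ a) {z : ℝ} (hz : |z| < 1) :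
    HasDerivAt (hyp a) (deriv (hyp a) z) z := (hasSum_deriv_hyp ha hz).1

theorem hasSum_mul_deriv_hyp {a : ℝ} (ha : 1 / 2 ≤ a) {z : ℝ} (hz : |z| < 1) :
    HasSum (fun n : ℕ => n * hypCoeff a n * z ^ n) (z * deriv (hyp a) z) := by
  refine ((hasSum_deriv_hyp ha hz).2.mul_left z).congr_fun ?_
  intro n
  rcases n with _ | n
  · simp
  · simp [pow_succ]; ring

theorem hyp_lowering {a : ℝ} (ha : 1 / 2 ≤ a) {z : ℝ} (hz : |z| < 1) :
    z * deriv (hyp (a + 1)) z + (a + 1 / 2) * hyp (a + 1) z = (a + 1 / 2) * hyp a z := by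
  have ha1 : 1 / 2 ≤ a + 1 := by linarith
  refine HasSum.unique (((hasSum_mul_deriv_hyp ha1 hz)).add ((hasSum_hyp ha1 hz).mul_left _)) ?_
  refine ((hasSum_hyp ha hz).mul_left (a + 1 / 2)).congr_fun fun n => ?_
  linear_combination (z ^ n) * hypCoeff_add_one (show 0 < a by linarith) n

/-- Together with `hyp_lowering` this is a first-order ladder in `a`; it takes the place of the
second-order hypergeometric equation. -/
theorem hyp_raising {a : ℝ} (ha : 1 / 2 ≤ a) {z : ℝ} (hz : |z| < 1) :
    (1 - z) * deriv (hyp a) z + (a - 1 / 2) * hyp a z = a ^ 2 / (a + 1 / 2) * hyp (a + 1) z := by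
  have ha0 : 0 < a := by linarith
  have hd : HasSum (fun n : ℕ => (n + 1) * hypCoeff a (n + 1) * z ^ n) (deriv (hyp a) z) := by
    have := (hasSum_nat_add_iff' 1).2 (hasSum_deriv_hyp ha hz).2
    simp only [Finset.range_one, Finset.sum_singleton, Nat.cast_zero, zero_mul, mul_zero,
      sub_zero] at this
    refine this.congr_fun fun n => ?_
    simp; ring
  have h := (hd.sub (hasSum_mul_deriv_hyp ha hz)).add ((hasSum_hyp ha hz).mul_left (a - 1 / 2))
  have e : (1 - z) * deriv (hyp a) z + (a - 1 / 2) * hyp a z =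
    deriv (hyp a) z - z * deriv (hyp a) z + (a - 1 / 2) * hyp a z := by ring
  rw [e]
  refine h.unique ?_
  refine ((hasSum_hyp (show 1 / 2 ≤ a + 1 by linarith) hz).mul_left _).congr_fun fun n => ?_
  have h1 := hypCoeff_add_one ha0 n
  have h2 : a + 1 / 2 + (n : ℝ) ≠ 0 := by positivity
  have h4 : (n : ℝ) + 1 ≠ 0 := by positivity
  have h5 : hypCoeff (a + 1) n = (a + 1 / 2) * hypCoeff a n / (a + 1 / 2 + n) := by
    rw [← h1]; field_simp
  rw [hypCoeff_succ ha0, h5]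
  have h6 : a + 1 / 2 ≠ 0 := by positivity
  field_simp
  ring

theorem one_le_hyp {a : ℝ} (ha : 1 / 2 ≤ a) {z : ℝ} (h0 : 0 ≤ z) (h1 : z < 1) : 1 ≤ hyp a z := by
  have h := hasSum_hyp ha (show |z| < 1 by rwa [abs_of_nonneg h0])
  have := sum_le_hasSum {0} (fun n _ => mul_nonneg (hypCoeff_pos (by linarith) n).le
    (pow_nonneg h0 n)) h
  simpa [hypCoeff_zero] using this

theorem hyp_pos {a : ℝ} (ha : 1 / 2 ≤ a) {z : ℝ} (h0 : 0 ≤ z) (h1 : z < 1) : 0 < hyp a z :=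
  one_pos.trans_le (one_le_hyp ha h0 h1)

theorem hyp_mono {a : ℝ} (ha : 1 / 2 ≤ a) {y z : ℝ} (h0 : 0 ≤ y) (hyz : y ≤ z) (h1 : z < 1) :
    hyp a y ≤ hyp a z :=
  hasSum_le (fun n => mul_le_mul_of_nonneg_left (pow_le_pow_left₀ h0 hyz n)
    (hypCoeff_pos (by linarith) n).le)
    (hasSum_hyp ha (by rw [abs_of_nonneg h0]; linarith))
    (hasSum_hyp ha (by rw [abs_of_nonneg (h0.trans hyz)]; exact h1))

theorem hyp_add_one_le {a : ℝ} (ha : 1 / 2 ≤ a) {z : ℝ} (h0 : 0 ≤ z) (h1 : z < 1) :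
    hyp (a + 1) z ≤ hyp a z := by
  have hz : |z| < 1 := by rwa [abs_of_nonneg h0]
  exact hasSum_le (fun n => mul_le_mul_of_nonneg_right (hypCoeff_add_one_le (by linarith) n)
    (pow_nonneg h0 n)) (hasSum_hyp (by linarith) hz) (hasSum_hyp ha hz)

theorem mul_hyp_le_neg_log {a : ℝ} (ha : 1 / 2 ≤ a) {z : ℝ} (h0 : 0 ≤ z) (h1 : z < 1) :
    z * hyp a z ≤ -log (1 - z) := by
  have hz : |z| < 1 := by rwa [abs_of_nonneg h0]
  refine hasSum_le (fun n => ?_) ((hasSum_hyp ha hz).mul_left z)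
    (Real.hasSum_pow_div_log_of_abs_lt_one hz)
  have := mul_le_mul_of_nonneg_right (hypCoeff_le ha n) (pow_nonneg h0 (n + 1))
  calc _ = hypCoeff a n * z ^ (n + 1) := by ring
    _ ≤ _ := this
    _ = _ := by ring

/-! ### The value at 1/2 in terms of Gamma -/

/-- The recursion `R a * R (a + 1) = a ^ 2` has at most one solution with `0 < R a ≤ a`. -/
theorem le_of_mul_add_one_eq_sq {R S : ℝ → ℝ}
    (hR : ∀ a, 1 / 2 ≤ a → 0 < R a ∧ R a ≤ a ∧ R a * R (a + 1) = a ^ 2)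
    (hS : ∀ a, 1 / 2 ≤ a → 0 < S a ∧ S a ≤ a ∧ S a * S (a + 1) = a ^ 2)
    {a : ℝ} (ha : 1 / 2 ≤ a) : S a ≤ R a := by
  -- Comparing the recursion at b and b + 1 gives R(b+2)/R(b) = ((b+1)/b)², and the same for S, so
  -- R/S is constant along a + 2n.
  have key : ∀ n : ℕ, R (a + 2 * n) * S a = S (a + 2 * n) * R a := by
    intro n
    induction n with
    | zero => simp [mul_comm]
    | succ n ih =>
      have hb : 1 / 2 ≤ a + 2 * n := by linarith [n.cast_nonneg (α := ℝ)]
      set b := a + 2 * (n : ℝ)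
      have e : a + 2 * ((n + 1 : ℕ) : ℝ) = b + 1 + 1 := by simp only [b]; push_cast; ring
      rw [e]
      obtain ⟨r0, -, r1⟩ := hR b hb
      obtain ⟨s0, -, s1⟩ := hS b hb
      obtain ⟨r2, -, r3⟩ := hR (b + 1) (by linarith)
      obtain ⟨s2, -, s3⟩ := hS (b + 1) (by linarith)
      have hb2 : 0 < b ^ 2 := by positivity
      have er : R (b + 1 + 1) * b ^ 2 = (b + 1) ^ 2 * R b := by rw [← r1, ← r3]; ring
      have es : S (b + 1 + 1) * b ^ 2 = (b + 1) ^ 2 * S b := by rw [← s1, ← s3]; ring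
      refine mul_right_cancel₀ hb2.ne' ?_
      linear_combination S a * er - R a * es + (b + 1) ^ 2 * ih
  by_contra! hlt
  obtain ⟨n, hn⟩ := exists_nat_gt (S a / (S a - R a))
  rw [div_lt_iff₀ (by linarith)] at hn
  have hb : 1 / 2 ≤ a + 2 * n := by linarith [n.cast_nonneg (α := ℝ)]
  have k := key n
  have hnb : (n : ℝ) ≤ a + 2 * n := by linarith [n.cast_nonneg (α := ℝ)]
  set b := a + 2 * (n : ℝ)
  obtain ⟨r0, r4, r1⟩ := hR b hb
  obtain ⟨r2, r3, -⟩ := hR (b + 1) (by linarith)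
  obtain ⟨-, s3, -⟩ := hS b hb
  obtain ⟨ra, -, -⟩ := hR a ha
  obtain ⟨sa, -, -⟩ := hS a ha
  -- R(b) = b²/R(b+1) ≥ b²/(b+1) ≥ b - 1, so R and S are asymptotically equal and the constant ratio
  -- must be 1. The choice of n makes b (S a - R a) > S a, contradicting `h2`.
  have h1 : b - 1 ≤ R b := by nlinarith
  have h2 : (b - 1) * S a ≤ b * R a := by nlinarith
  nlinarith

/-- The logarithmic derivative at `π / 2` of the regular solution, see `regSol`. -/
noncomputable def regSlope (a : ℝ) : ℝ :=
  a ^ 2 / (a + 1 / 2) * hyp (a + 1) (1 / 2) / hyp a (1 / 2)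

/-- The quotient of Gamma values on the right hand side of the algebraic equation. -/
noncomputable def gammaQuot (a : ℝ) : ℝ := 2 * (Gamma ((1 + a) / 2) / Gamma (a / 2)) ^ 2

/-- At z = 1/2 one has z = 1 - z, so the lowering relation for a and the raising relation for a + 1
have the same left-hand side. Equating the right-hand sides gives the product formula. -/
theorem regSlope_spec {a : ℝ} (ha : 1 / 2 ≤ a) :
    0 < regSlope a ∧ regSlope a ≤ a ∧ regSlope a * regSlope (a + 1) = a ^ 2 := by
  have h0 : 0 < hyp a (1 / 2) := hyp_pos ha (by norm_num) (by norm_num)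
  have h1 : 0 < hyp (a + 1) (1 / 2) := hyp_pos (by linarith) (by norm_num) (by norm_num)
  have hz : |(1 / 2 : ℝ)| < 1 := by norm_num [abs_lt]
  refine ⟨by unfold regSlope; positivity, ?_, ?_⟩
  · unfold regSlope
    rw [div_le_iff₀ h0]
    have hle := hyp_add_one_le ha (show (0 : ℝ) ≤ 1 / 2 by norm_num) (by norm_num)
    have : a ^ 2 / (a + 1 / 2) ≤ a := by
      rw [div_le_iff₀ (by positivity)]; nlinarith
    gcongr
  · have e1 := hyp_lowering ha hz
    have e2 := hyp_raising (show 1 / 2 ≤ a + 1 by linarith) hz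
    have e3 : (a + 1) ^ 2 / (a + 1 + 1 / 2) * hyp (a + 1 + 1) (1 / 2) =
        (a + 1 / 2) * hyp a (1 / 2) := by
      rw [← e1, ← e2]; ring
    have h2 : a + 1 / 2 ≠ 0 := by positivity
    unfold regSlope
    rw [e3]
    field_simp

/-- The upper bound is log-convexity of Γ at the midpoint of a/2 and a/2 + 1; the product telescopes
by Γ(s + 1) = sΓ(s). -/
theorem gammaQuot_spec {a : ℝ} (ha : 0 < a) :
    0 < gammaQuot a ∧ gammaQuot a ≤ a ∧ gammaQuot a * gammaQuot (a + 1) = a ^ 2 := by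
  have h0 : 0 < Gamma (a / 2) := Gamma_pos_of_pos (by positivity)
  have h1 : 0 < Gamma ((1 + a) / 2) := Gamma_pos_of_pos (by positivity)
  have e2 : Gamma (a / 2 + 1) = a / 2 * Gamma (a / 2) := Gamma_add_one (by positivity)
  refine ⟨by unfold gammaQuot; positivity, ?_, ?_⟩
  · have h := Gamma_mul_add_mul_le_rpow_Gamma_mul_rpow_Gamma (s := a / 2) (t := a / 2 + 1)
      (a := 1 / 2) (b := 1 / 2) (by positivity) (by positivity) (by norm_num) (by norm_num)
      (by norm_num)
    rw [show 1 / 2 * (a / 2) + 1 / 2 * (a / 2 + 1) = (1 + a) / 2 by ring, e2,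
      ← Real.mul_rpow h0.le (by positivity), ← Real.sqrt_eq_rpow] at h
    have h' : Gamma ((1 + a) / 2) ^ 2 ≤ Gamma (a / 2) * (a / 2 * Gamma (a / 2)) := by
      rw [← Real.sq_sqrt (show 0 ≤ Gamma (a / 2) * (a / 2 * Gamma (a / 2)) by positivity)]
      gcongr
    unfold gammaQuot
    rw [div_pow, ← le_div_iff₀' (by norm_num), div_le_iff₀ (by positivity)]
    linarith
  · unfold gammaQuot
    rw [show (1 + (a + 1)) / 2 = a / 2 + 1 by ring, show (a + 1) / 2 = (1 + a) / 2 by ring, e2]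
    field_simp

/-- The quotient of values of hypergeometric functions at `1 / 2` in terms of the Gamma
function. -/
theorem regSlope_eq_gammaQuot {a : ℝ} (ha : 1 / 2 ≤ a) : regSlope a = gammaQuot a :=
  le_antisymm
    (le_of_mul_add_one_eq_sq (fun _ h => gammaQuot_spec (by linarith)) (fun _ h => regSlope_spec h) ha)
    (le_of_mul_add_one_eq_sq (fun _ h => regSlope_spec h) (fun _ h => gammaQuot_spec (by linarith)) ha)

/-! ### The regular solution on (0, π) -/

/-- The solution of `u'' = -a (1 - a) / sin² u` on `(0, π)` that behaves like `t ^ a` at `0`. -/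
noncomputable def regSol (a t : ℝ) : ℝ :=
  sin (t / 2) ^ a * cos (t / 2) ^ (1 - a) * hyp a (sin (t / 2) ^ 2)

/-- The derivative of `regSol a` on `(0, π)`. -/
noncomputable def regSolDeriv (a t : ℝ) : ℝ :=
  a * (cos t / sin t) * regSol a t + a ^ 2 / (a + 1 / 2) * regSol (a + 1) t

theorem half_angle_pos {t : ℝ} (ht : t ∈ Ioo 0 π) :
    0 < sin (t / 2) ∧ 0 < cos (t / 2) ∧ sin (t / 2) ^ 2 < 1 ∧ cos (t / 2) ^ 2 < 1 := by
  have h1 : 0 < sin (t / 2) := sin_pos_of_pos_of_lt_pi (by linarith [ht.1]) (by linarith [ht.1, ht.2])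
  have h2 : 0 < cos (t / 2) := cos_pos_of_mem_Ioo ⟨by linarith [ht.1, pi_pos], by linarith [ht.2]⟩
  refine ⟨h1, h2, ?_, ?_⟩ <;> nlinarith [sin_sq_add_cos_sq (t / 2)]

theorem sin_cos_half (t : ℝ) :
    sin t = 2 * sin (t / 2) * cos (t / 2) ∧ cos t = cos (t / 2) ^ 2 - sin (t / 2) ^ 2 := by
  have h1 := sin_two_mul (t / 2)
  have h2 := cos_two_mul' (t / 2)
  rw [show 2 * (t / 2) = t by ring] at h1 h2
  exact ⟨h1, h2⟩

theorem abs_sin_sq_lt {t : ℝ} (ht : t ∈ Ioo 0 π) : |sin (t / 2) ^ 2| < 1 := by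
  rw [abs_of_nonneg (sq_nonneg _)]
  exact (half_angle_pos ht).2.2.1

theorem regSol_pos {a : ℝ} (ha : 1 / 2 ≤ a) {t : ℝ} (ht : t ∈ Ioo 0 π) : 0 < regSol a t := by
  obtain ⟨h1, h2, h3, -⟩ := half_angle_pos ht
  have := hyp_pos ha (sq_nonneg (sin (t / 2))) h3
  unfold regSol
  positivity

theorem rpow_prefactor_add_one (a : ℝ) {t : ℝ} (ht : t ∈ Ioo 0 π) :
    sin (t / 2) ^ (a + 1) * cos (t / 2) ^ (1 - (a + 1)) =
      sin (t / 2) ^ a * cos (t / 2) ^ (1 - a) * (sin (t / 2) / cos (t / 2)) := by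
  obtain ⟨h1, h2, -, -⟩ := half_angle_pos ht
  rw [show 1 - (a + 1) = 1 - a - 1 by ring, rpow_add_one h1.ne', rpow_sub_one h2.ne']
  ring

theorem hasDerivAt_regSol_aux {a : ℝ} (ha : 1 / 2 ≤ a) {t : ℝ} (ht : t ∈ Ioo 0 π) :
    HasDerivAt (regSol a) (sin (t / 2) ^ a * cos (t / 2) ^ (1 - a) *
      ((a * cos (t / 2) ^ 2 - (1 - a) * sin (t / 2) ^ 2) / (2 * sin (t / 2) * cos (t / 2)) *
        hyp a (sin (t / 2) ^ 2) + deriv (hyp a) (sin (t / 2) ^ 2) *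
          (sin (t / 2) * cos (t / 2)))) t := by
  obtain ⟨h1, h2, -, -⟩ := half_angle_pos ht
  have hh : HasDerivAt (fun t : ℝ => t / 2) (1 / 2) t := (hasDerivAt_id t).div_const 2
  have hs : HasDerivAt (fun t : ℝ => sin (t / 2)) (cos (t / 2) * (1 / 2)) t := hh.sin
  have hc : HasDerivAt (fun t : ℝ => cos (t / 2)) (-sin (t / 2) * (1 / 2)) t := hh.cos
  have hs' := hs.rpow_const (p := a) (Or.inl h1.ne')
  have hc' := hc.rpow_const (p := 1 - a) (Or.inl h2.ne')
  have hF := (hasDerivAt_hyp ha (abs_sin_sq_lt ht)).comp t (hs.pow 2)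
  refine ((hs'.mul hc').mul hF).congr_deriv ?_
  rw [rpow_sub_one h1.ne', rpow_sub_one h2.ne']
  simp only [Function.comp_def, Pi.mul_apply, Pi.pow_apply]
  field_simp
  norm_num
  ring

theorem hasDerivAt_regSol {a : ℝ} (ha : 1 / 2 ≤ a) {t : ℝ} (ht : t ∈ Ioo 0 π) :
    HasDerivAt (regSol a) (regSolDeriv a t) t := by
  obtain ⟨h1, h2, -, -⟩ := half_angle_pos ht
  refine (hasDerivAt_regSol_aux ha ht).congr_deriv ?_
  have hr := hyp_raising ha (abs_sin_sq_lt ht)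
  have hk : 1 - sin (t / 2) ^ 2 = cos (t / 2) ^ 2 := by
    rw [← sin_sq_add_cos_sq (t / 2)]; ring
  rw [hk] at hr
  unfold regSolDeriv regSol
  rw [rpow_prefactor_add_one a ht, (sin_cos_half t).1, (sin_cos_half t).2]
  have e : ∀ p x : ℝ, a ^ 2 / (a + 1 / 2) * (p * x * hyp (a + 1) (sin (t / 2) ^ 2)) =
      p * x * (a ^ 2 / (a + 1 / 2) * hyp (a + 1) (sin (t / 2) ^ 2)) := fun p x => by ring
  rw [e, ← hr]
  field_simp
  ring

theorem hasDerivAt_regSol_add_one {a : ℝ} (ha : 1 / 2 ≤ a) {t : ℝ} (ht : t ∈ Ioo 0 π) :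
    HasDerivAt (regSol (a + 1))
      (-a * (cos t / sin t) * regSol (a + 1) t + (a + 1 / 2) * regSol a t) t := by
  obtain ⟨h1, h2, -, -⟩ := half_angle_pos ht
  refine (hasDerivAt_regSol_aux (show 1 / 2 ≤ a + 1 by linarith) ht).congr_deriv ?_
  have hr := hyp_lowering ha (abs_sin_sq_lt ht)
  unfold regSol
  rw [rpow_prefactor_add_one a ht, (sin_cos_half t).1, (sin_cos_half t).2]
  have e : ∀ p : ℝ, (a + 1 / 2) * (p * hyp a (sin (t / 2) ^ 2)) =
      p * ((a + 1 / 2) * hyp a (sin (t / 2) ^ 2)) := fun p => by ring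
  rw [e, ← hr]
  field_simp
  ring

/-- Differentiating one ladder relation and inserting both, the cot · `regSol (a + 1)` terms cancel,
and a² (cot² + 1) = a²/sin² combines with -a/sin². -/
theorem hasDerivAt_regSolDeriv {a : ℝ} (ha : 1 / 2 ≤ a) {t : ℝ} (ht : t ∈ Ioo 0 π) :
    HasDerivAt (regSolDeriv a) (-(a * (1 - a) * (1 / sin t ^ 2) * regSol a t)) t := by
  have hst : sin t ≠ 0 := (sin_pos_of_pos_of_lt_pi ht.1 ht.2).ne'
  have hcot := (hasDerivAt_cos t).div (hasDerivAt_sin t) hst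
  refine (((hcot.const_mul a).mul (hasDerivAt_regSol ha ht)).add
    ((hasDerivAt_regSol_add_one ha ht).const_mul (a ^ 2 / (a + 1 / 2)))).congr_deriv ?_
  have h6 : a + 1 / 2 ≠ 0 := by positivity
  unfold regSolDeriv
  simp only [Pi.div_apply]
  have hc : cos t ^ 2 = 1 - sin t ^ 2 := by rw [← sin_sq_add_cos_sq t]; ring
  field_simp
  ring_nf
  rw [hc]
  ring

theorem regSol_le {a : ℝ} (ha : 1 / 2 ≤ a) (ha1 : a ≤ 1) {t : ℝ} (h0 : 0 < t) (ht : t ≤ π / 2) :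
    regSol a t ≤ hyp a (1 / 2) * t ^ a := by
  have hpi := pi_pos
  have ht' : t ∈ Ioo 0 π := ⟨h0, by linarith⟩
  obtain ⟨h1, h2, h3, -⟩ := half_angle_pos ht'
  have hs : sin (t / 2) ≤ t := (sin_le (by linarith)).trans (by linarith)
  have hcos : 0 ≤ cos t := cos_nonneg_of_mem_Icc ⟨by linarith, ht⟩
  have hs2 : sin (t / 2) ^ 2 ≤ 1 / 2 := by
    have := (sin_cos_half t).2
    nlinarith [sin_sq_add_cos_sq (t / 2)]
  have hF := hyp_mono ha (sq_nonneg (sin (t / 2))) hs2 (by norm_num)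
  have hF0 := hyp_pos ha (sq_nonneg (sin (t / 2))) h3
  have hk : cos (t / 2) ^ (1 - a) ≤ 1 := rpow_le_one h2.le (cos_le_one _) (by linarith)
  have hsa : sin (t / 2) ^ a ≤ t ^ a := rpow_le_rpow h1.le hs (by linarith)
  calc _ ≤ t ^ a * 1 * hyp a (1 / 2) := by unfold regSol; gcongr
    _ = _ := by ring

theorem regSol_le_mul_sqrt {a : ℝ} (ha : 1 / 2 ≤ a) (ha1 : a ≤ 1) {t : ℝ} (ht : t ∈ Ioo (0 : ℝ) 1) :
    regSol a t ≤ hyp a (1 / 2) * √t := by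
  refine (regSol_le ha ha1 ht.1 (by linarith [ht.2, pi_gt_three])).trans ?_
  have h0 : 0 < hyp a (1 / 2) := hyp_pos ha (by norm_num) (by norm_num)
  have : t ^ a ≤ √t := by
    rw [sqrt_eq_rpow]
    exact rpow_le_rpow_of_exponent_ge ht.1 ht.2.le ha
  gcongr

theorem regSol_add_one_le {a : ℝ} (ha : 1 / 2 ≤ a) {t : ℝ} (h0 : 0 < t) (ht : t ≤ π / 2) :
    regSol (a + 1) t ≤ regSol a t := by
  have hpi := pi_pos
  have ht' : t ∈ Ioo 0 π := ⟨h0, by linarith⟩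
  obtain ⟨h1, h2, h3, -⟩ := half_angle_pos ht'
  have hcos : 0 ≤ cos t := cos_nonneg_of_mem_Icc ⟨by linarith, ht⟩
  have hsk : sin (t / 2) / cos (t / 2) ≤ 1 := by
    rw [div_le_one h2]
    have := (sin_cos_half t).2
    nlinarith
  have hF := hyp_add_one_le ha (sq_nonneg (sin (t / 2))) h3
  have hF0 := hyp_pos ha (sq_nonneg (sin (t / 2))) h3
  unfold regSol
  rw [rpow_prefactor_add_one a ht']
  have hp : 0 < sin (t / 2) ^ a * cos (t / 2) ^ (1 - a) := by positivity
  have hF1 := (hyp_pos (show 1 / 2 ≤ a + 1 by linarith) (sq_nonneg (sin (t / 2))) h3).le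
  calc _ ≤ sin (t / 2) ^ a * cos (t / 2) ^ (1 - a) * 1 * hyp a (sin (t / 2) ^ 2) := by gcongr
    _ = _ := by ring

theorem regSolDeriv_le {a : ℝ} (ha : 1 / 2 ≤ a) (ha1 : a ≤ 1) {t : ℝ} (h0 : 0 < t) (ht : t ≤ 1) :
    regSolDeriv a t ≤ 2 * regSol a t / t := by
  have hpi := pi_gt_three
  have ht' : t ∈ Ioo 0 π := ⟨h0, by linarith⟩
  have h1 := regSol_pos ha ht'
  have h2 := regSol_add_one_le ha h0 (by linarith)
  have h3 : 0 < cos t := cos_pos_of_mem_Ioo ⟨by linarith, by linarith⟩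
  have h4 : 0 < sin t := sin_pos_of_pos_of_lt_pi ht'.1 ht'.2
  have hcot : cos t / sin t ≤ 1 / t := by
    have := lt_tan h0 (by linarith)
    rw [tan_eq_sin_div_cos, lt_div_iff₀ h3] at this
    rw [div_le_div_iff₀ h4 h0]
    linarith
  have hK : a ^ 2 / (a + 1 / 2) ≤ 1 := by
    rw [div_le_one (by positivity)]; nlinarith
  have h5 : 1 ≤ 1 / t := by rw [le_div_iff₀ h0]; linarith
  have h6 := regSol_pos (show 1 / 2 ≤ a + 1 by linarith) ht'
  calc _ ≤ 1 * (1 / t) * regSol a t + 1 * regSol a t := by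
        unfold regSolDeriv; gcongr
    _ ≤ 1 * (1 / t) * regSol a t + (1 / t) * regSol a t := by gcongr
    _ = _ := by ring

theorem regSol_pi_div_two (a : ℝ) : regSol a (π / 2) = √2 / 2 * hyp a (1 / 2) := by
  have e : π / 2 / 2 = π / 4 := by ring
  have h : (0 : ℝ) < √2 / 2 := by positivity
  unfold regSol
  rw [e, sin_pi_div_four, cos_pi_div_four, ← rpow_add h]
  norm_num [div_pow]

theorem regSolDeriv_pi_div_two {a : ℝ} (ha : 1 / 2 ≤ a) :
    regSolDeriv a (π / 2) = regSlope a * regSol a (π / 2) := by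
  have h := (hyp_pos ha (show (0 : ℝ) ≤ 1 / 2 by norm_num) (by norm_num)).ne'
  unfold regSolDeriv regSlope
  rw [regSol_pi_div_two, regSol_pi_div_two, cos_pi_div_two]
  field_simp
  ring

theorem tendsto_regSol {a : ℝ} (ha : 1 / 2 ≤ a) (ha1 : a ≤ 1) :
    Tendsto (regSol a) (𝓝[>] 0) (𝓝 0) := by
  have hpi := pi_gt_three
  have h : Tendsto (fun t : ℝ => hyp a (1 / 2) * t ^ a) (𝓝[>] 0) (𝓝 0) := by
    have : ContinuousAt (fun t : ℝ => hyp a (1 / 2) * t ^ a) 0 :=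
      continuousAt_const.mul (continuousAt_rpow_const 0 a (Or.inr (by linarith)))
    have h2 := this.tendsto.mono_left (nhdsWithin_le_nhds (s := Ioi 0))
    rwa [zero_rpow (by linarith), mul_zero] at h2
  have hm : Ioo (0 : ℝ) 1 ∈ 𝓝[>] (0 : ℝ) := Ioo_mem_nhdsGT one_pos
  refine tendsto_of_tendsto_of_tendsto_of_le_of_le' tendsto_const_nhds h ?_ ?_
  · filter_upwards [hm] with t ht using (regSol_pos ha ⟨ht.1, by linarith [ht.2]⟩).le
  · filter_upwards [hm] with t ht using regSol_le ha ha1 ht.1 (by linarith [ht.2])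

/-- At the far end π the hypergeometric factor has only a logarithmic singularity, beaten by the
factor sin(t/2)^(1/2). In the constant -4, one factor 2 is from log of a square and the other from
cos²(t/2) ≥ 1/2. -/
theorem tendsto_regSol_half_reflect :
    Tendsto (fun t => regSol (1 / 2) (π - t)) (𝓝[>] 0) (𝓝 0) := by
  have hpi := pi_gt_three
  have hm : Ioo (0 : ℝ) 1 ∈ 𝓝[>] (0 : ℝ) := Ioo_mem_nhdsGT one_pos
  have hs : Tendsto (fun t : ℝ => sin (t / 2)) (𝓝[>] 0) (𝓝[>] 0) := by
    refine tendsto_nhdsWithin_iff.2 ⟨?_, ?_⟩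
    · have : ContinuousAt (fun t : ℝ => sin (t / 2)) 0 := by fun_prop
      simpa [ContinuousAt] using this.tendsto.mono_left (nhdsWithin_le_nhds (s := Ioi 0))
    · filter_upwards [hm] with t ht
      exact (half_angle_pos ⟨ht.1, by linarith [ht.2]⟩).1
  have hl := ((tendsto_log_mul_rpow_nhdsGT_zero (r := 1 / 2) (by norm_num)).comp hs).const_mul (-4)
  rw [mul_zero] at hl
  refine tendsto_of_tendsto_of_tendsto_of_le_of_le' tendsto_const_nhds hl ?_ ?_
  · filter_upwards [hm] with t ht using (regSol_pos le_rfl ⟨by linarith [ht.2], by linarith [ht.1]⟩).le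
  · filter_upwards [hm] with t ht
    obtain ⟨h1, h2, h3, h4⟩ := half_angle_pos (t := t) ⟨ht.1, by linarith [ht.2]⟩
    have e : (π - t) / 2 = π / 2 - t / 2 := by ring
    have hcos : 0 ≤ cos t := cos_nonneg_of_mem_Icc ⟨by linarith [ht.1], by linarith [ht.2]⟩
    have hk : 1 / 2 ≤ cos (t / 2) ^ 2 := by
      have := (sin_cos_half t).2
      nlinarith [sin_sq_add_cos_sq (t / 2)]
    have hF := mul_hyp_le_neg_log (le_refl (1 / 2 : ℝ)) (sq_nonneg (cos (t / 2))) h4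
    have hF0 := hyp_pos (le_refl (1 / 2 : ℝ)) (sq_nonneg (cos (t / 2))) h4
    have e2 : 1 - cos (t / 2) ^ 2 = sin (t / 2) ^ 2 := by
      rw [← sin_sq_add_cos_sq (t / 2)]; ring
    rw [e2, log_pow] at hF
    have hF' : hyp (1 / 2) (cos (t / 2) ^ 2) ≤ -4 * log (sin (t / 2)) := by
      push_cast at hF
      nlinarith
    have hc1 : cos (t / 2) ^ (1 / 2 : ℝ) ≤ 1 := rpow_le_one h2.le (cos_le_one _) (by norm_num)
    unfold regSol
    rw [e, sin_pi_div_two_sub, cos_pi_div_two_sub]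
    calc _ ≤ 1 * sin (t / 2) ^ (1 - 1 / 2 : ℝ) * (-4 * log (sin (t / 2))) := by gcongr
      _ = _ := by norm_num [Function.comp_def]; ring

/-! ### Positive solutions: monotonicity, Riccati bound, Sturm comparison -/

theorem V_of_le {β θ : ℝ} (hβ : π < β) (h : θ ≤ π / 2) : V β θ = 1 / sin θ ^ 2 := by
  unfold V
  rcases h.lt_or_eq with h | h
  · rw [if_pos h]
  · rw [if_neg h.not_lt, if_pos (by linarith), h, sin_pi_div_two]
    norm_num

theorem V_of_ge {β θ : ℝ} (hβ : π < β) (h : π / 2 ≤ θ) (h' : θ ≤ β / 2) : V β θ = 1 := by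
  unfold V
  rw [if_neg h.not_gt, if_pos (by linarith)]

theorem one_le_V {β θ : ℝ} (hβ : π < β) (h : θ ∈ Ioo 0 (β / 2)) : 1 ≤ V β θ := by
  rcases le_total θ (π / 2) with h1 | h1
  · have hs : 0 < sin θ := sin_pos_of_pos_of_lt_pi h.1 (by linarith [pi_pos])
    rw [V_of_le hβ h1, le_div_iff₀ (by positivity), one_mul]
    exact sin_sq_le_one θ
  · exact (V_of_ge hβ h1 h.2.le).ge

/-- A positive function on `(0, 1)` cannot grow at least as fast as a multiple of `log`. -/
theorem false_of_div_le_deriv {q q' : ℝ → ℝ} {k : ℝ} (hk : 0 < k)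
    (hq : ∀ θ ∈ Ioo (0 : ℝ) 1, 0 ≤ q θ) (hd : ∀ θ ∈ Ioo (0 : ℝ) 1, HasDerivAt q (q' θ) θ)
    (hle : ∀ θ ∈ Ioo (0 : ℝ) 1, k / θ ≤ q' θ) : False := by
  have hg : ∀ θ ∈ Ioo (0 : ℝ) 1, HasDerivAt (fun t => q t - k * log t) (q' θ - k * θ⁻¹) θ :=
    fun θ hθ => (hd θ hθ).sub ((hasDerivAt_log hθ.1.ne').const_mul k)
  have hmono : MonotoneOn (fun t => q t - k * log t) (Ioo 0 1) := by
    refine monotoneOn_of_deriv_nonneg (convex_Ioo 0 1)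
      (fun θ hθ => (hg θ hθ).continuousAt.continuousWithinAt)
      (fun θ hθ => ?_) (fun θ hθ => ?_)
    · rw [interior_Ioo] at hθ
      exact (hg θ hθ).differentiableAt.differentiableWithinAt
    · rw [interior_Ioo] at hθ
      rw [(hg θ hθ).deriv, ← div_eq_mul_inv]
      linarith [hle θ hθ]
  have hh : (1 / 2 : ℝ) ∈ Ioo (0 : ℝ) 1 := by norm_num
  -- With this M, monotonicity between exp(-M) and 1/2 gives q(exp(-M)) ≤ k (log 2 - 2) < 0.
  set M := q (1 / 2) / k + 2 with hM
  have hM2 : 2 ≤ M := by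
    have := div_nonneg (hq _ hh) hk.le
    linarith
  have he : rexp (-M) ≤ 1 / 2 := by
    have h1 : rexp (-M) ≤ rexp (-1) := exp_le_exp.2 (by linarith)
    have h2 := exp_neg_one_lt_d9
    linarith
  have hm : rexp (-M) ∈ Ioo (0 : ℝ) 1 := ⟨exp_pos _, by linarith⟩
  have h3 := hmono hm hh he
  simp only [log_exp] at h3
  have h4 : k * M = q (1 / 2) + 2 * k := by
    rw [hM]; field_simp
  have h5 : log (1 / 2) = -log 2 := by rw [one_div, log_inv]
  rw [h5] at h3
  have := hq _ hm
  have h6 := log_two_lt_d9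
  nlinarith

theorem eq_zero_of_hasDerivAt_zero_of_tendsto {f : ℝ → ℝ} {a b : ℝ}
    (hf : ∀ θ ∈ Ico a b, HasDerivAt f 0 θ) (ht : Tendsto f (𝓝[<] b) (𝓝 0)) :
    ∀ θ ∈ Ico a b, f θ = 0 := by
  intro θ hθ
  have hc : ∀ t ∈ Ico a b, f t = f θ := by
    intro t ht
    have := (convex_Ico a b).norm_image_sub_le_of_norm_hasDerivWithin_le (f := f) (f' := fun _ => 0)
      (C := 0) (fun x hx => (hf x hx).hasDerivWithinAt) (by simp) hθ ht
    simpa [sub_eq_zero] using this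
  have hev : (fun _ => f θ) =ᶠ[𝓝[<] b] f := by
    filter_upwards [Ico_mem_nhdsLT (hθ.1.trans_lt hθ.2)] with t ht using (hc t ht).symm
  exact tendsto_nhds_unique (tendsto_const_nhds.congr' hev) ht

namespace IsPositiveSolution

variable {β c : ℝ} {ψ : ℝ → ℝ}

theorem hasDerivAt (h : IsPositiveSolution β c ψ) {θ : ℝ} (hθ : θ ∈ Ioo 0 (β / 2)) :
    HasDerivAt ψ (deriv ψ θ) θ := (h.differentiableAt θ hθ).hasDerivAt

theorem strictAntiOn_deriv (h : IsPositiveSolution β c ψ) (hβ : π < β) (hc : 0 < c) :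
    StrictAntiOn (deriv ψ) (Ioo 0 (β / 2)) := by
  refine strictAntiOn_of_deriv_neg (convex_Ioo _ _)
    (fun θ hθ => (h.ode θ hθ).continuousAt.continuousWithinAt) fun θ hθ => ?_
  rw [interior_Ioo] at hθ
  rw [(h.ode θ hθ).deriv]
  have := one_le_V hβ hθ
  have := h.pos θ hθ
  have : 0 < c * V β θ * ψ θ := by positivity
  linarith

/-- The one-sided derivative at β/2 does not by itself control `deriv ψ` nearby. The mean value
theorem supplies points with small derivative; monotonicity later turns this into a limit. -/
theorem exists_abs_deriv_lt (h : IsPositiveSolution β c ψ) {θ ε : ℝ} (hθ : θ ∈ Ioo 0 (β / 2))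
    (hε : 0 < ε) : ∃ ξ ∈ Ioo θ (β / 2), |deriv ψ ξ| < ε := by
  have hd : HasDerivWithinAt ψ 0 (Iio (β / 2)) (β / 2) :=
    h.right_bc.mono_of_mem_nhdsWithin (Icc_mem_nhdsLT (hθ.1.trans hθ.2))
  rw [hasDerivWithinAt_iff_tendsto_slope' (by simp)] at hd
  have h1 := (Metric.tendsto_nhds.1 hd ε hε).and (Ioo_mem_nhdsLT hθ.2)
  obtain ⟨t, ht, htm⟩ := h1.exists
  obtain ⟨ξ, hξ, he⟩ := exists_hasDerivAt_eq_slope ψ (deriv ψ) htm.2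
    (h.continuousOn.mono (Icc_subset_Icc (hθ.1.trans htm.1).le le_rfl))
    (fun y hy => h.hasDerivAt ⟨(hθ.1.trans htm.1).trans hy.1, hy.2⟩)
  refine ⟨ξ, ⟨htm.1.trans hξ.1, hξ.2⟩, ?_⟩
  rw [he]
  rw [Real.dist_eq, sub_zero, slope_comm, slope_def_field] at ht
  exact ht

theorem deriv_pos (h : IsPositiveSolution β c ψ) (hβ : π < β) (hc : 0 < c) {θ : ℝ}
    (hθ : θ ∈ Ioo 0 (β / 2)) : 0 < deriv ψ θ := by
  have nonneg : ∀ t ∈ Ioo 0 (β / 2), 0 ≤ deriv ψ t := by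
    intro t ht
    by_contra! hneg
    obtain ⟨ξ, hξ, hlt⟩ := h.exists_abs_deriv_lt ht (neg_pos.2 hneg)
    have := h.strictAntiOn_deriv hβ hc ht ⟨ht.1.trans hξ.1, hξ.2⟩ hξ.1
    linarith [neg_abs_le (deriv ψ ξ)]
  obtain ⟨t, h1, h2⟩ := exists_between hθ.2
  have ht : t ∈ Ioo 0 (β / 2) := ⟨hθ.1.trans h1, h2⟩
  exact (nonneg t ht).trans_lt (h.strictAntiOn_deriv hβ hc hθ ht h1)

theorem tendsto_deriv (h : IsPositiveSolution β c ψ) (hβ : π < β) (hc : 0 < c) :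
    Tendsto (deriv ψ) (𝓝[<] (β / 2)) (𝓝 0) := by
  rw [Metric.tendsto_nhds]
  intro ε hε
  have hp := pi_pos
  have hm : π / 2 ∈ Ioo 0 (β / 2) := ⟨by linarith, by linarith⟩
  obtain ⟨ξ, hξ, hlt⟩ := h.exists_abs_deriv_lt hm hε
  filter_upwards [Ioo_mem_nhdsLT hξ.2] with t ht
  have hξ' : ξ ∈ Ioo 0 (β / 2) := ⟨hm.1.trans hξ.1, hξ.2⟩
  have ht' : t ∈ Ioo 0 (β / 2) := ⟨hξ'.1.trans ht.1, ht.2⟩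
  have h1 := h.deriv_pos hβ hc ht'
  have h2 := h.strictAntiOn_deriv hβ hc hξ' ht' ht.1
  rw [Real.dist_eq, sub_zero, abs_of_pos h1]
  exact h2.trans ((le_abs_self _).trans_lt hlt)

theorem tendsto_right (h : IsPositiveSolution β c ψ) (hβ : π < β) :
    Tendsto ψ (𝓝[<] (β / 2)) (𝓝 (ψ (β / 2))) := by
  have hp := pi_pos
  have := h.continuousOn (β / 2) ⟨by linarith, le_rfl⟩
  exact this.tendsto.mono_left (nhdsWithin_le_of_mem (Icc_mem_nhdsLT (by linarith)))

/-- Used with d = c for uniqueness and matching, and with d ≠ c for comparison. -/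
theorem hasDerivAt_wronskian (h : IsPositiveSolution β c ψ) {φ φ' : ℝ → ℝ} {d θ : ℝ}
    (hθ : θ ∈ Ioo 0 (β / 2)) (h1 : HasDerivAt φ (φ' θ) θ)
    (h2 : HasDerivAt φ' (-(d * V β θ * φ θ)) θ) :
    HasDerivAt (fun t => deriv ψ t * φ t - ψ t * φ' t) ((d - c) * V β θ * ψ θ * φ θ) θ := by
  refine (((h.ode θ hθ).mul h1).sub ((h.hasDerivAt hθ).mul h2)).congr_deriv ?_
  ring

/-- In the variable s = log θ, the function p = θψ'/ψ satisfies dp/ds = p - p² - cθ²V ≤ -(w² + (p -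
1/2)²) on (0, 1), since sin θ ≤ θ. So arctan((p - 1/2)/w) falls at rate at least w on a half-line of
s, although it is bounded. -/
theorem le_quarter (h : IsPositiveSolution β c ψ) (hβ : π < β) : c ≤ 1 / 4 := by
  by_contra! hlt
  have hp := pi_gt_three
  set w := √(c - 1 / 4) with hw
  have h0 : 0 < w := sqrt_pos.2 (by linarith)
  have hsq : w ^ 2 = c - 1 / 4 := sq_sqrt (by linarith)
  set p : ℝ → ℝ := fun t => t * deriv ψ t / ψ t with hpdef
  have hmem : ∀ θ ∈ Ioo (0 : ℝ) 1, θ ∈ Ioo 0 (β / 2) := fun θ hθ => ⟨hθ.1, by linarith [hθ.2]⟩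
  have hd : ∀ θ ∈ Ioo (0 : ℝ) 1, HasDerivAt (fun t => π / 2 - arctan ((p t - 1 / 2) / w))
      ((-(p θ - p θ ^ 2 - c * (θ ^ 2 * V β θ)) / θ) * (w / (w ^ 2 + (p θ - 1 / 2) ^ 2))) θ := by
    intro θ hθ
    have hpos := h.pos θ (hmem θ hθ)
    have hp1 : HasDerivAt p ((p θ - p θ ^ 2 - c * (θ ^ 2 * V β θ)) / θ) θ := by
      refine ((((hasDerivAt_id θ).mul (h.ode θ (hmem θ hθ))).div (h.hasDerivAt (hmem θ hθ))
        hpos.ne')).congr_deriv ?_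
      have := hθ.1.ne'
      simp only [hpdef, id, Pi.mul_apply]
      field_simp
      ring
    refine (((hp1.sub_const (1 / 2)).div_const w).arctan.const_sub (π / 2)).congr_deriv ?_
    have := hθ.1.ne'
    have h3 : w ^ 2 + (p θ - 1 / 2) ^ 2 ≠ 0 := by positivity
    have h4 : 1 + ((p θ - 1 / 2) / w) ^ 2 = (w ^ 2 + (p θ - 1 / 2) ^ 2) / w ^ 2 := by
      field_simp
    rw [h4]
    field_simp
  refine false_of_div_le_deriv h0 (fun θ _ => ?_) hd fun θ hθ => ?_
  · linarith [arctan_lt_pi_div_two ((p θ - 1 / 2) / w)]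
  · have hs : 0 < sin θ := sin_pos_of_pos_of_lt_pi hθ.1 (by linarith [hθ.2])
    have hV : 1 ≤ θ ^ 2 * V β θ := by
      rw [V_of_le hβ (by linarith [hθ.2]), mul_one_div, le_div_iff₀ (by positivity), one_mul]
      have := sin_le hθ.1.le
      gcongr
    have hden : 0 < w ^ 2 + (p θ - 1 / 2) ^ 2 := by positivity
    have hnum : w ^ 2 + (p θ - 1 / 2) ^ 2 ≤ -(p θ - p θ ^ 2 - c * (θ ^ 2 * V β θ)) := by
      nlinarith
    have hθ0 := hθ.1
    calc w / θ = (w ^ 2 + (p θ - 1 / 2) ^ 2) / θ * (w / (w ^ 2 + (p θ - 1 / 2) ^ 2)) := by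
          field_simp
      _ ≤ _ := by gcongr

/-- Sturm comparison with a solution that is small at `0`. -/
theorem le_of_sq_le (h : IsPositiveSolution β c ψ) (hβ : π < β) (hc : 0 < c) {C : ℝ}
    (hC : ∀ θ ∈ Ioo (0 : ℝ) 1, ψ θ ^ 2 ≤ C * θ) {d : ℝ} {χ : ℝ → ℝ} (hd : 0 < d)
    (hχ : IsPositiveSolution β d χ) : d ≤ c := by
  by_contra! hlt
  have hp := pi_gt_three
  have hmem : ∀ θ ∈ Ioo (0 : ℝ) 1, θ ∈ Ioo 0 (β / 2) := fun θ hθ => ⟨hθ.1, by linarith [hθ.2]⟩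
  -- W decreases strictly to 0 at β/2, so W ≥ W 1 > 0 on (0, 1), and (χ/ψ)' = W/ψ² ≥ W 1/(Cθ).
  set W : ℝ → ℝ := fun t => deriv χ t * ψ t - χ t * deriv ψ t with hW
  have hWd : ∀ θ ∈ Ioo 0 (β / 2), HasDerivAt W ((c - d) * V β θ * χ θ * ψ θ) θ :=
    fun θ hθ => hχ.hasDerivAt_wronskian hθ (h.hasDerivAt hθ) (h.ode θ hθ)
  have hWanti : StrictAntiOn W (Ioo 0 (β / 2)) := by
    refine strictAntiOn_of_deriv_neg (convex_Ioo _ _)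
      (fun θ hθ => (hWd θ hθ).continuousAt.continuousWithinAt) fun θ hθ => ?_
    rw [interior_Ioo] at hθ
    rw [(hWd θ hθ).deriv]
    have h1 := one_le_V hβ hθ
    have h2 := h.pos θ hθ
    have h3 := hχ.pos θ hθ
    have : 0 < (d - c) * V β θ * χ θ * ψ θ := by
      have := sub_pos.2 hlt
      positivity
    linarith
  have hWt : Tendsto W (𝓝[<] (β / 2)) (𝓝 0) := by
    have := ((hχ.tendsto_deriv hβ hd).mul (h.tendsto_right hβ)).sub
      ((hχ.tendsto_right hβ).mul (h.tendsto_deriv hβ hc))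
    simpa using this
  have m1 : (1 : ℝ) ∈ Ioo 0 (β / 2) := ⟨one_pos, by linarith⟩
  -- Any point beyond 1 serves: the limit gives W ≥ 0 there, hence W 1 > 0.
  have m2 : (5 / 4 : ℝ) ∈ Ioo 0 (β / 2) := ⟨by norm_num, by linarith⟩
  have hW2 : 0 ≤ W (5 / 4) := by
    refine le_of_tendsto hWt ?_
    filter_upwards [Ioo_mem_nhdsLT m2.2] with t ht
    exact (hWanti m2 ⟨m2.1.trans ht.1, ht.2⟩ ht.1).le
  have hW1 : 0 < W 1 := hW2.trans_lt (hWanti m1 m2 (by norm_num))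
  have hC0 : 0 < C := by
    have hh : (1 / 2 : ℝ) ∈ Ioo (0 : ℝ) 1 := by norm_num
    have h1 := hC _ hh
    have h2 := h.pos _ (hmem _ hh)
    nlinarith [pow_pos h2 2]
  refine false_of_div_le_deriv (q := fun t => χ t / ψ t) (q' := fun t => W t / ψ t ^ 2)
    (div_pos hW1 hC0) (fun θ hθ => ?_) (fun θ hθ => ?_) fun θ hθ => ?_
  · exact (div_pos (hχ.pos θ (hmem θ hθ)) (h.pos θ (hmem θ hθ))).le
  · exact (hχ.hasDerivAt (hmem θ hθ)).div (h.hasDerivAt (hmem θ hθ)) (h.pos θ (hmem θ hθ)).ne'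
  · have h1 := hWanti (hmem θ hθ) m1 hθ.2
    have h2 := h.pos θ (hmem θ hθ)
    rw [div_div]
    have := hC θ hθ
    have h3 := hW1.le.trans h1.le
    gcongr

/-- Positive solutions are unique up to a constant multiple. -/
theorem eq_const_mul (h : IsPositiveSolution β c ψ) (hβ : π < β) (hc : 0 < c) {χ : ℝ → ℝ}
    (hχ : IsPositiveSolution β c χ) :
    ∃ k : ℝ, 0 < k ∧ ∀ θ ∈ Icc 0 (β / 2), χ θ = k * ψ θ := by
  have hp := pi_gt_three
  have hW0 : ∀ θ ∈ Ioo 0 (β / 2), deriv χ θ * ψ θ - χ θ * deriv ψ θ = 0 := by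
    intro θ hθ
    refine eq_zero_of_hasDerivAt_zero_of_tendsto
      (f := fun t => deriv χ t * ψ t - χ t * deriv ψ t) (a := θ) (b := β / 2)
      (fun t ht => ?_) ?_ θ ⟨le_rfl, hθ.2⟩
    · have ht' : t ∈ Ioo 0 (β / 2) := ⟨hθ.1.trans_le ht.1, ht.2⟩
      refine (hχ.hasDerivAt_wronskian ht' (h.hasDerivAt ht') (h.ode t ht')).congr_deriv ?_
      ring
    · have := ((hχ.tendsto_deriv hβ hc).mul (h.tendsto_right hβ)).sub
        ((hχ.tendsto_right hβ).mul (h.tendsto_deriv hβ hc))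
      simpa using this
  have m1 : (1 : ℝ) ∈ Ioo 0 (β / 2) := ⟨one_pos, by linarith⟩
  have hk : 0 < χ 1 / ψ 1 := div_pos (hχ.pos 1 m1) (h.pos 1 m1)
  have hin : EqOn χ (fun θ => χ 1 / ψ 1 * ψ θ) (Ioo 0 (β / 2)) := by
    intro θ hθ
    have := (convex_Ioo 0 (β / 2)).norm_image_sub_le_of_norm_hasDerivWithin_le
      (f := fun t => χ t / ψ t) (f' := fun _ => 0) (C := 0) (fun t ht => ?_) (by simp) m1 hθ
    · rw [zero_mul, norm_le_zero_iff, sub_eq_zero, div_eq_iff (h.pos θ hθ).ne'] at this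
      exact this
    · refine (((hχ.hasDerivAt ht).div (h.hasDerivAt ht) (h.pos t ht).ne').congr_deriv
        ?_).hasDerivWithinAt
      rw [hW0 t ht, zero_div]
  refine ⟨_, hk, ?_⟩
  have hcl : closure (Ioo 0 (β / 2)) = Icc 0 (β / 2) := closure_Ioo (by linarith)
  have := hin.of_subset_closure hχ.continuousOn (h.continuousOn.const_mul (χ 1 / ψ 1))
    Ioo_subset_Icc_self hcl.ge
  exact this

/-- On the interval where the potential is constant the solution is explicit. -/
theorem deriv_pi_div_two (h : IsPositiveSolution β c ψ) (hβ : π < β) (hc : 0 < c) :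
    √c * ((β - π) / 2) < π / 2 ∧
      deriv ψ (π / 2) = √c * tan (√c * ((β - π) / 2)) * ψ (π / 2) := by
  have hp := pi_pos
  set w := √c with hw
  have h0 : 0 < w := sqrt_pos.2 hc
  have hsq : w ^ 2 = c := sq_sqrt hc.le
  have hmem : ∀ θ ∈ Ico (π / 2) (β / 2), θ ∈ Ioo 0 (β / 2) :=
    fun θ hθ => ⟨by linarith [hθ.1], hθ.2⟩
  have hE : ∀ θ ∈ Ico (π / 2) (β / 2),
      deriv ψ θ * cos (w * (β / 2 - θ)) - ψ θ * (w * sin (w * (β / 2 - θ))) = 0 := by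
    refine eq_zero_of_hasDerivAt_zero_of_tendsto (fun θ hθ => ?_) ?_
    · have hi : HasDerivAt (fun t => w * (β / 2 - t)) (-w) θ :=
        (((hasDerivAt_id θ).const_sub (β / 2)).const_mul w).congr_deriv (by ring)
      refine (h.hasDerivAt_wronskian (d := c) (hmem θ hθ) (hi.cos.congr_deriv ?_)
        ((hi.sin.const_mul w).congr_deriv ?_)).congr_deriv ?_
      · ring
      · rw [V_of_ge hβ hθ.1 hθ.2.le, ← hsq]; ring
      · ring
    · have hcc : Tendsto (fun t => cos (w * (β / 2 - t))) (𝓝[<] (β / 2)) (𝓝 1) := by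
        have : ContinuousAt (fun t => cos (w * (β / 2 - t))) (β / 2) := by fun_prop
        simpa [ContinuousAt] using this.tendsto.mono_left (nhdsWithin_le_nhds (s := Iio (β / 2)))
      have hss : Tendsto (fun t => w * sin (w * (β / 2 - t))) (𝓝[<] (β / 2)) (𝓝 0) := by
        have : ContinuousAt (fun t => w * sin (w * (β / 2 - t))) (β / 2) := by fun_prop
        simpa [ContinuousAt] using this.tendsto.mono_left (nhdsWithin_le_nhds (s := Iio (β / 2)))
      have := ((h.tendsto_deriv hβ hc).mul hcc).sub ((h.tendsto_right hβ).mul hss)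
      simpa using this
  have hm : π / 2 ∈ Ico (π / 2) (β / 2) := ⟨le_rfl, by linarith⟩
  -- Otherwise the cosine vanishes at β/2 - π/(2w), which lies in [π/2, β/2), and `hE` makes ψ zero
  -- there.
  have hlt : w * ((β - π) / 2) < π / 2 := by
    by_contra! hge
    have hq : 0 < π / 2 / w := by positivity
    have hm' : β / 2 - π / 2 / w ∈ Ico (π / 2) (β / 2) := by
      refine ⟨?_, by linarith⟩
      have : π / 2 / w ≤ (β - π) / 2 := by rw [div_le_iff₀ h0]; linarith
      linarith
    have h1 := hE _ hm'
    rw [show w * (β / 2 - (β / 2 - π / 2 / w)) = π / 2 by field_simp; ring, cos_pi_div_two,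
      sin_pi_div_two] at h1
    have h2 := h.pos _ (hmem _ hm')
    nlinarith
  refine ⟨hlt, ?_⟩
  have h1 := hE _ hm
  rw [show β / 2 - π / 2 = (β - π) / 2 by ring] at h1
  have hcos : 0 < cos (w * ((β - π) / 2)) :=
    cos_pos_of_mem_Ioo ⟨by nlinarith, hlt⟩
  rw [tan_eq_sin_div_cos, mul_div_assoc', div_mul_eq_mul_div, eq_div_iff hcos.ne']
  linarith

theorem congr (h : IsPositiveSolution β c ψ) {χ : ℝ → ℝ} (hβ : π < β)
    (he : EqOn χ ψ (Icc 0 (β / 2))) : IsPositiveSolution β c χ := by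
  have hp := pi_pos
  have hev : ∀ θ ∈ Ioo 0 (β / 2), χ =ᶠ[𝓝 θ] ψ := fun θ hθ => by
    filter_upwards [Ioo_mem_nhds hθ.1 hθ.2] with t ht using he (Ioo_subset_Icc_self ht)
  refine ⟨h.continuousOn.congr he, fun θ hθ => ?_, fun θ hθ => ?_, fun θ hθ => ?_, ?_, ?_⟩
  · rw [he (Ioo_subset_Icc_self hθ)]; exact h.pos θ hθ
  · exact (h.differentiableAt θ hθ).congr_of_eventuallyEq (hev θ hθ)
  · rw [he (Ioo_subset_Icc_self hθ)]
    exact (h.ode θ hθ).congr_of_eventuallyEq (hev θ hθ).deriv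
  · rw [he ⟨le_rfl, by linarith⟩]; exact h.left_bc
  · exact h.right_bc.congr he (he ⟨by linarith, le_rfl⟩)

end IsPositiveSolution

/-! ### Gluing and the explicit solutions -/

theorem hasDerivAt_ite_le {f g : ℝ → ℝ} {a d : ℝ} (hf : HasDerivAt f d a) (hg : HasDerivAt g d a)
    (e : f a = g a) : HasDerivAt (fun t => if t ≤ a then f t else g t) d a := by
  rw [← hasDerivWithinAt_univ, ← Iic_union_Ici (a := a)]
  refine HasDerivWithinAt.union ?_ ?_
  · exact hf.hasDerivWithinAt.congr (fun t ht => if_pos ht) (if_pos le_rfl)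
  · refine hg.hasDerivWithinAt.congr (fun t ht => ?_) ?_
    · rcases (show a ≤ t from ht).lt_or_eq with h | rfl
      · exact if_neg h.not_ge
      · rw [if_pos le_rfl, e]
    · rw [if_pos le_rfl, e]

/-- Gluing a solution on `(0, π / 2]` to the explicit one on `[π / 2, β / 2]`. -/
theorem isPositiveSolution_glue {β c : ℝ} (hβ : π < β) (hc : 0 < c)
    (hlt : √c * ((β - π) / 2) < π / 2) {u u' : ℝ → ℝ} (hpos : ∀ t ∈ Ioc 0 (π / 2), 0 < u t)
    (hu : ∀ t ∈ Ioo 0 π, HasDerivAt u (u' t) t)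
    (hu' : ∀ t ∈ Ioo 0 π, HasDerivAt u' (-(c * (1 / sin t ^ 2) * u t)) t)
    (h0 : Tendsto u (𝓝[>] 0) (𝓝 0)) (hu0 : u 0 = 0)
    (e0 : u (π / 2) = cos (√c * ((β - π) / 2)))
    (e1 : u' (π / 2) = √c * sin (√c * ((β - π) / 2))) :
    IsPositiveSolution β c (fun t => if t ≤ π / 2 then u t else cos (√c * (β / 2 - t))) := by
  have hp := pi_pos
  set w := √c with hw
  have hw0 : 0 < w := sqrt_pos.2 hc
  have hsq : w ^ 2 = c := sq_sqrt hc.le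
  set v : ℝ → ℝ := fun t => cos (w * (β / 2 - t)) with hv
  set v' : ℝ → ℝ := fun t => w * sin (w * (β / 2 - t)) with hv'
  set f : ℝ → ℝ := fun t => if t ≤ π / 2 then u t else v t with hf
  set f' : ℝ → ℝ := fun t => if t ≤ π / 2 then u' t else v' t with hf'
  have hi : ∀ θ, HasDerivAt (fun t => w * (β / 2 - t)) (-w) θ := fun θ =>
    (((hasDerivAt_id θ).const_sub (β / 2)).const_mul w).congr_deriv (by ring)
  have dv : ∀ t, HasDerivAt v (v' t) t := fun t => (hi t).cos.congr_deriv (by simp only [hv']; ring)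
  have dv' : ∀ t, HasDerivAt v' (-(c * v t)) t := fun t =>
    ((hi t).sin.const_mul w).congr_deriv (by rw [← hsq]; simp only [hv]; ring)
  have hsub : β / 2 - π / 2 = (β - π) / 2 := by ring
  -- Values and slopes match and the potential equals 1 at π/2 from both sides, so the glued
  -- function is twice differentiable there.
  have ev : u (π / 2) = v (π / 2) := by simp only [hv]; rw [e0, hsub]
  have ev' : u' (π / 2) = v' (π / 2) := by simp only [hv']; rw [e1, hsub]
  have hmid : π / 2 ∈ Ioo 0 π := ⟨by linarith, by linarith⟩
  have hfd : ∀ t, 0 < t → HasDerivAt f (f' t) t := by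
    intro t ht
    rcases lt_trichotomy t (π / 2) with h | h | h
    · simp only [hf', if_pos h.le]
      refine (hu t ⟨ht, by linarith⟩).congr_of_eventuallyEq ?_
      filter_upwards [Iio_mem_nhds h] with s hs using if_pos (le_of_lt hs)
    · subst h
      simp only [hf', if_pos le_rfl]
      exact hasDerivAt_ite_le (hu _ hmid) (ev' ▸ dv _) ev
    · simp only [hf', if_neg h.not_ge]
      refine (dv t).congr_of_eventuallyEq ?_
      filter_upwards [Ioi_mem_nhds h] with s hs using if_neg (not_le.2 hs)
  have hfd' : ∀ t ∈ Ioo 0 (β / 2), HasDerivAt f' (-(c * V β t * f t)) t := by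
    intro t ht
    rcases lt_trichotomy t (π / 2) with h | h | h
    · simp only [hf, if_pos h.le, V_of_le hβ h.le]
      refine (hu' t ⟨ht.1, by linarith⟩).congr_of_eventuallyEq ?_
      filter_upwards [Iio_mem_nhds h] with s hs using if_pos (le_of_lt hs)
    · subst h
      have hV := V_of_ge hβ le_rfl ht.2.le
      simp only [hf, if_pos le_rfl, hV]
      refine hasDerivAt_ite_le ?_ ?_ ev'
      · refine (hu' _ hmid).congr_deriv ?_
        rw [sin_pi_div_two]; ring
      · refine (dv' _).congr_deriv ?_
        rw [← ev]; ring
    · simp only [hf, if_neg h.not_ge, V_of_ge hβ h.le ht.2.le]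
      refine ((dv' t).congr_of_eventuallyEq ?_).congr_deriv (by ring)
      filter_upwards [Ioi_mem_nhds h] with s hs using if_neg (not_le.2 hs)
  have hderiv : ∀ t ∈ Ioo 0 (β / 2), deriv f =ᶠ[𝓝 t] f' := fun t ht => by
    filter_upwards [Ioi_mem_nhds ht.1] with s hs using (hfd s hs).deriv
  refine ⟨fun t ht => ?_, fun t ht => ?_, fun t ht => (hfd t ht.1).differentiableAt,
    fun t ht => (hfd' t ht).congr_of_eventuallyEq (hderiv t ht), ?_, ?_⟩
  · rcases ht.1.eq_or_lt with rfl | h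
    · have hf0 : f 0 = 0 := by simp only [hf]; rw [if_pos (by linarith), hu0]
      have : ContinuousWithinAt f (Ici 0) 0 := by
        rw [← continuousWithinAt_Ioi_iff_Ici, ContinuousWithinAt, hf0]
        refine h0.congr' ?_
        filter_upwards [Ioo_mem_nhdsGT hmid.1] with s hs using (if_pos hs.2.le).symm
      exact this.mono Icc_subset_Ici_self
    · exact (hfd t h).continuousAt.continuousWithinAt
  · simp only [hf]
    split_ifs with h
    · exact hpos t ⟨ht.1, h⟩
    · push Not at h
      refine cos_pos_of_mem_Ioo ⟨?_, ?_⟩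
      · have : 0 < w * (β / 2 - t) := mul_pos hw0 (by linarith [ht.2])
        linarith
      · refine lt_trans ?_ hlt
        exact mul_lt_mul_of_pos_left (by linarith) hw0
  · simp only [hf]; rw [if_pos (by linarith), hu0]
  · have h := (hfd (β / 2) (by linarith)).hasDerivWithinAt (s := Icc 0 (β / 2))
    refine h.congr_deriv ?_
    have hn : ¬ β / 2 ≤ π / 2 := by linarith
    simp only [hf', if_neg hn, hv', sub_self, mul_zero, sin_zero]

theorem alpha_spec {c : ℝ} (hc0 : 0 < c) (hc : c ≤ 1 / 4) :
    1 / 2 ≤ alpha c ∧ alpha c < 1 ∧ alpha c * (1 - alpha c) = c := by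
  have h1 : alpha c * (1 - alpha c) = c := (alpha_isGreatest hc).1
  have h2 : 1 / 2 ≤ alpha c := by
    unfold alpha
    linarith [sqrt_nonneg (1 - 4 * c)]
  refine ⟨h2, ?_, h1⟩
  nlinarith

theorem alpha_quarter : alpha (1 / 4) = 1 / 2 := by
  unfold alpha
  norm_num

theorem gammaQuot_alpha (c : ℝ) : gammaQuot (alpha c) =
    2 * (Gamma ((3 + √(1 - 4 * c)) / 4) / Gamma ((1 + √(1 - 4 * c)) / 4)) ^ 2 := by
  unfold gammaQuot alpha
  congr 4 <;> ring

theorem gammaQuot_half : gammaQuot (1 / 2) = 2 * (Gamma (3 / 4) / Gamma (1 / 4)) ^ 2 := by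
  unfold gammaQuot
  norm_num

theorem regSol_zero {a : ℝ} (ha : 1 / 2 ≤ a) : regSol a 0 = 0 := by
  unfold regSol
  rw [zero_div, sin_zero, zero_rpow (by linarith)]
  simp

theorem psi_of_le {β c θ : ℝ} (hθ : θ ≤ π / 2) :
    psi β c θ = cos (√c * ((β - π) / 2)) / regSol (alpha c) (π / 2) * regSol (alpha c) θ := by
  have h2 : √2 / 2 = 1 / √2 := by
    rw [div_eq_div_iff (by norm_num) (by positivity), mul_self_sqrt (by norm_num), one_mul]
  have h2' : √2 ≠ 0 := by positivity
  unfold psi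
  rw [if_pos hθ, regSol_pi_div_two, h2, mul_div_assoc]
  unfold regSol hyp
  generalize ordinaryHypergeometric (1 / 2 : ℝ) (1 / 2) (alpha c + 1 / 2) (1 / 2 : ℝ) = H
  field_simp

theorem mul_sin_of_solvesAlg {β c : ℝ} (hβ : π < β) (h : SolvesAlg β c) :
    0 < cos (√c * ((β - π) / 2)) ∧
    gammaQuot (alpha c) * cos (√c * ((β - π) / 2)) = √c * sin (√c * ((β - π) / 2)) := by
  obtain ⟨⟨h0, h1, h2⟩, h3⟩ := h
  have hp := pi_pos
  have hB : 0 ≤ √c * ((β - π) / 2) := mul_nonneg (sqrt_nonneg c) (by linarith)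
  have hcos : 0 < cos (√c * ((β - π) / 2)) := cos_pos_of_mem_Ioo ⟨by linarith, h3⟩
  refine ⟨hcos, ?_⟩
  rw [← gammaQuot_alpha, tan_eq_sin_div_cos] at h2
  rw [← h2, mul_assoc, div_mul_cancel₀ _ hcos.ne']

theorem isPositiveSolution_psi {β c : ℝ} (hβ : π < β) (h : SolvesAlg β c) :
    IsPositiveSolution β c (psi β c) := by
  have hp := pi_pos
  obtain ⟨hcos, hslope⟩ := mul_sin_of_solvesAlg hβ h
  obtain ⟨⟨h0, h1, -⟩, hlt⟩ := h
  obtain ⟨ha, ha1, hac⟩ := alpha_spec h0 h1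
  have hmid : π / 2 ∈ Ioo 0 π := ⟨by linarith, by linarith⟩
  have hU := regSol_pos ha hmid
  set A := cos (√c * ((β - π) / 2)) / regSol (alpha c) (π / 2) with hA
  have hA0 : 0 < A := div_pos hcos hU
  have key := isPositiveSolution_glue (u := fun t => A * regSol (alpha c) t)
    (u' := fun t => A * regSolDeriv (alpha c) t) hβ h0 hlt
    (fun t ht => mul_pos hA0 (regSol_pos ha ⟨ht.1, by linarith [ht.2]⟩))
    (fun t ht => (hasDerivAt_regSol ha ht).const_mul A)
    (fun t ht => ((hasDerivAt_regSolDeriv ha ht).const_mul A).congr_deriv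
      (by rw [hac]; ring))
    (by simpa using (tendsto_regSol ha ha1.le).const_mul A)
    (by rw [regSol_zero ha, mul_zero])
    (by rw [hA]; field_simp)
    (by
      rw [regSolDeriv_pi_div_two ha, regSlope_eq_gammaQuot ha, ← hslope, hA]
      field_simp)
  refine key.congr hβ fun t _ => ?_
  by_cases ht : t ≤ π / 2
  · simp only [if_pos ht]
    exact psi_of_le ht
  · simp only [if_neg ht, psi]

theorem betaCr_mem : π < betaCr ∧ betaCr < 2 * π := betaCr_spec.1

theorem sqrt_quarter : √(1 / 4 : ℝ) = 1 / 2 := by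
  rw [show (1 / 4 : ℝ) = (1 / 2) ^ 2 by norm_num, sqrt_sq (by norm_num)]

theorem solvesAlg_betaCr : SolvesAlg betaCr (1 / 4) := by
  have hp := pi_pos
  refine ⟨⟨by norm_num, le_rfl, ?_⟩, ?_⟩
  · rw [← gammaQuot_alpha, alpha_quarter, gammaQuot_half, sqrt_quarter,
      show 1 / 2 * ((betaCr - π) / 2) = (betaCr - π) / 4 by ring, betaCr_spec.2.1]
    ring
  · rw [sqrt_quarter]
    linarith [betaCr_mem.2]

theorem psiCr_eqOn : EqOn psiCr (psi betaCr (1 / 4)) (Icc 0 (betaCr / 2)) := by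
  intro θ hθ
  have hp := pi_pos
  unfold psiCr psi
  rw [alpha_quarter, sqrt_quarter]
  split_ifs with h
  · have hs : 0 ≤ sin (θ / 2) := sin_nonneg_of_nonneg_of_le_pi (by linarith [hθ.1]) (by linarith)
    have hk : 0 ≤ cos (θ / 2) := cos_nonneg_of_mem_Icc ⟨by linarith [hθ.1], by linarith⟩
    have e : sin θ ^ (1 / 2 : ℝ) =
        √2 * sin (θ / 2) ^ (1 / 2 : ℝ) * cos (θ / 2) ^ (1 / 2 : ℝ) := by
      rw [(sin_cos_half θ).1, mul_rpow (by positivity) hk, mul_rpow (by norm_num) hs, ← sqrt_eq_rpow]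
    rw [e, show 1 / 2 * (betaCr - π) / 2 = (betaCr - π) / 4 by ring,
      show (1 : ℝ) - 1 / 2 = 1 / 2 by norm_num, show (1 / 2 : ℝ) + 1 / 2 = 1 by norm_num]
    ring
  · rfl

theorem isPositiveSolution_psiCr : IsPositiveSolution betaCr (1 / 4) psiCr :=
  (isPositiveSolution_psi betaCr_mem.1 solvesAlg_betaCr).congr betaCr_mem.1 psiCr_eqOn

/-- At c = 1/4 both `regSol (1/2)` and its reflection t ↦ π - t solve the equation and vanish at 0,
so value and slope at π/2 can be prescribed. The reflected part has a nonnegative coefficient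
because tan((β - π)/4) ≤ 2L when β ≤ β_cr. -/
theorem exists_isPositiveSolution_quarter {β : ℝ} (hβ : π < β) (hcr : β ≤ betaCr) :
    ∃ ψ : ℝ → ℝ, IsPositiveSolution β (1 / 4) ψ := by
  have hp := pi_pos
  have h2 := betaCr_mem.2
  have ha : (1 / 2 : ℝ) ≤ 1 / 2 := le_rfl
  have hmid : π / 2 ∈ Ioo 0 π := ⟨by linarith, by linarith⟩
  have hU := regSol_pos ha hmid
  set U := regSol (1 / 2) (π / 2)
  have hL := (regSlope_spec ha).1
  have hLe : regSlope (1 / 2) = gammaQuot (1 / 2) := regSlope_eq_gammaQuot ha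
  set L := regSlope (1 / 2)
  have hcos : 0 < cos ((β - π) / 4) := cos_pos_of_mem_Ioo ⟨by linarith, by linarith⟩
  have hsin : 0 < sin ((β - π) / 4) := sin_pos_of_pos_of_lt_pi (by linarith) (by linarith)
  have htan : sin ((β - π) / 4) ≤ 2 * L * cos ((β - π) / 4) := by
    have h3 : tan ((β - π) / 4) ≤ tan ((betaCr - π) / 4) :=
      strictMonoOn_tan.monotoneOn ⟨by linarith, by linarith⟩ ⟨by linarith, by linarith⟩
        (by linarith)
    rw [betaCr_spec.2.1, tan_eq_sin_div_cos, div_le_iff₀ hcos] at h3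
    rw [hLe, gammaQuot_half]
    linarith
  set C := cos ((β - π) / 4)
  set S := sin ((β - π) / 4)
  -- A and D solve (A + D) U = C and (A - D) L U = S/2, the matching conditions at π/2.
  set A := (C / U + S / (2 * L * U)) / 2 with hA
  set D := (C / U - S / (2 * L * U)) / 2 with hD
  have hA0 : 0 < A := by positivity
  have hD0 : 0 ≤ D := by
    have : S / (2 * L * U) ≤ C / U := by
      rw [div_le_div_iff₀ (by positivity) hU]
      nlinarith
    rw [hD]; linarith
  have hB : √(1 / 4) * ((β - π) / 2) = (β - π) / 4 := by rw [sqrt_quarter]; ring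
  have hpi : π - π / 2 = π / 2 := by ring
  have hr : ∀ t ∈ Ioo 0 π, π - t ∈ Ioo 0 π := fun t ht => ⟨by linarith [ht.2], by linarith [ht.1]⟩
  refine ⟨_, isPositiveSolution_glue (u := fun t => A * regSol (1 / 2) t + D * regSol (1 / 2) (π - t))
    (u' := fun t => A * regSolDeriv (1 / 2) t - D * regSolDeriv (1 / 2) (π - t)) hβ (by norm_num)
    (by rw [hB]; linarith) (fun t ht => ?_) (fun t ht => ?_) (fun t ht => ?_) ?_ ?_ ?_ ?_⟩
  · have ht' : t ∈ Ioo 0 π := ⟨ht.1, by linarith [ht.2]⟩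
    have h3 := regSol_pos ha ht'
    have h4 := regSol_pos ha (hr t ht')
    positivity
  · have h3 := (hasDerivAt_regSol ha (hr t ht)).comp t ((hasDerivAt_id t).const_sub π)
    exact (((hasDerivAt_regSol ha ht).const_mul A).add (h3.const_mul D)).congr_deriv (by ring)
  · have h3 := (hasDerivAt_regSolDeriv ha (hr t ht)).comp t ((hasDerivAt_id t).const_sub π)
    refine (((hasDerivAt_regSolDeriv ha ht).const_mul A).sub (h3.const_mul D)).congr_deriv ?_
    rw [sin_pi_sub]
    ring
  · simpa using ((tendsto_regSol ha (by norm_num)).const_mul A).add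
      (tendsto_regSol_half_reflect.const_mul D)
  · have : regSol (1 / 2) (π - 0) = 0 := by
      unfold regSol
      rw [sub_zero, cos_pi_div_two, zero_rpow (by norm_num)]
      simp
    rw [this, regSol_zero ha]
    simp
  · rw [hB, hpi, hA, hD]
    field_simp
    ring
  · rw [hB, hpi, regSolDeriv_pi_div_two ha, sqrt_quarter, hA, hD]
    field_simp
    ring

/-! ### Weak derivatives -/

theorem integrable_mul_of_locallyIntegrableOn {f φ : ℝ → ℝ} {U : Set ℝ}
    (hf : LocallyIntegrableOn f U) (hφ : Continuous φ) (hc : HasCompactSupport φ)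
    (hU : tsupport φ ⊆ U) : Integrable (fun x => f x * φ x) := by
  have h1 := (hf.integrableOn_compact_subset hU hc).mul_continuousOn hφ.continuousOn hc
  refine (integrableOn_iff_integrable_of_support_subset ?_).1 h1
  exact (Function.support_mul_subset_right f φ).trans (subset_tsupport φ)

theorem setIntegral_mul_eq {f φ : ℝ → ℝ} {U : Set ℝ} (hU : tsupport φ ⊆ U) :
    ∫ x in U, f x * φ x = ∫ x, f x * φ x := by
  refine setIntegral_eq_integral_of_forall_compl_eq_zero fun x hx => ?_
  rw [image_eq_zero_of_notMem_tsupport fun h => hx (hU h), mul_zero]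

/-- A classical derivative is a weak derivative. -/
theorem hasWeakDerivOn_of_hasDerivAt {a b : ℝ} {f f' : ℝ → ℝ}
    (hf : ∀ x ∈ Ioo a b, HasDerivAt f (f' x) x) (hi : LocallyIntegrableOn f' (Ioo a b)) :
    HasWeakDerivOn a b f f' := by
  intro φ hφ hc hU
  have hdφ : Continuous (deriv φ) := hφ.continuous_deriv (by simp)
  have hU' : tsupport (deriv φ) ⊆ Ioo a b := tsupport_deriv_subset.trans hU
  have hfc : LocallyIntegrableOn f (Ioo a b) := ContinuousOn.locallyIntegrableOn
    (fun x hx => (hf x hx).continuousAt.continuousWithinAt) measurableSet_Ioo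
  have i1 := integrable_mul_of_locallyIntegrableOn hfc hφ.continuous hc hU
  have i2 := integrable_mul_of_locallyIntegrableOn hfc hdφ hc.deriv hU'
  have i3 := integrable_mul_of_locallyIntegrableOn hi hφ.continuous hc hU
  -- Off its support φ vanishes locally, so fφ is differentiable on the whole line whatever f does
  -- outside (a, b).
  have hd : ∀ x, HasDerivAt (fun x => f x * φ x) (f' x * φ x + f x * deriv φ x) x := by
    intro x
    by_cases hx : x ∈ tsupport φ
    · exact (hf x (hU hx)).mul (hφ.differentiable (by simp) x).hasDerivAt
    · rw [image_eq_zero_of_notMem_tsupport hx, deriv_of_notMem_tsupport hx, mul_zero, mul_zero,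
        add_zero]
      refine (hasDerivAt_const x 0).congr_of_eventuallyEq ?_
      filter_upwards [notMem_tsupport_iff_eventuallyEq.1 hx] with y hy
      rw [hy]; simp
  have h0 := integral_eq_zero_of_hasDerivAt_of_integrable hd (i3.add i2) i1
  rw [integral_add i3 i2] at h0
  rw [setIntegral_mul_eq hU', setIntegral_mul_eq hU]
  linarith

theorem HasWeakDerivOn.ae_eq {a b : ℝ} {f g h : ℝ → ℝ} (hg : HasWeakDerivOn a b f g)
    (hh : HasWeakDerivOn a b f h) (ig : LocallyIntegrableOn g (Ioo a b))
    (ih : LocallyIntegrableOn h (Ioo a b)) : g =ᵐ[volume.restrict (Ioo a b)] h := by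
  have key := isOpen_Ioo.ae_eq_zero_of_integral_contDiff_smul_eq_zero (ig.sub ih)
    fun φ hφ hc hU => ?_
  · rw [Filter.EventuallyEq, ae_restrict_iff' measurableSet_Ioo]
    filter_upwards [key] with x hx hm using sub_eq_zero.1 (hx hm)
  · have h1 := hg φ hφ hc hU
    rw [hh φ hφ hc hU, neg_inj, setIntegral_mul_eq hU, setIntegral_mul_eq hU] at h1
    have i1 := integrable_mul_of_locallyIntegrableOn ig hφ.continuous hc hU
    have i2 := integrable_mul_of_locallyIntegrableOn ih hφ.continuous hc hU
    have := integral_sub i1 i2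
    rw [h1, sub_self] at this
    rw [← this]
    congr 1
    ext x
    simp only [smul_eq_mul, Pi.sub_apply]
    ring

theorem reflect_sub (β : ℝ) (ψ : ℝ → ℝ) (θ : ℝ) : reflect β ψ (β - θ) = reflect β ψ θ := by
  unfold reflect
  rcases lt_trichotomy θ (β / 2) with h | h | h
  · rw [if_neg (by linarith), if_pos h.le, sub_sub_cancel]
  · subst h
    rw [if_pos (by linarith), if_pos le_rfl]
    congr 1; ring
  · rw [if_pos (by linarith), if_neg (by linarith)]

theorem reflect_of_le {β θ : ℝ} (ψ : ℝ → ℝ) (h : θ ≤ β / 2) : reflect β ψ θ = ψ θ := if_pos h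

theorem memLp_rpow {b r : ℝ} (hb : 0 ≤ b) (hr : -(1 / 2) < r) :
    MemLp (fun x => x ^ r) 2 (volume.restrict (Ioo 0 b)) ∧
    MemLp (fun x => (b - x) ^ r) 2 (volume.restrict (Ioo 0 b)) := by
  have h1 : IntervalIntegrable (fun x : ℝ => x ^ (2 * r)) volume 0 b :=
    intervalIntegral.intervalIntegrable_rpow' (by linarith)
  have h2 : IntervalIntegrable (fun x : ℝ => (b - x) ^ (2 * r)) volume 0 b := by
    simpa using (h1.comp_sub_left b).symm
  rw [intervalIntegrable_iff_integrableOn_Ioo_of_le hb] at h1 h2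
  refine ⟨(memLp_two_iff_integrable_sq ?_).2 (h1.congr_fun ?_ measurableSet_Ioo),
    (memLp_two_iff_integrable_sq ?_).2 (h2.congr_fun ?_ measurableSet_Ioo)⟩
  · exact Measurable.aestronglyMeasurable (by fun_prop)
  · intro x hx
    simp only
    rw [mul_comm, rpow_mul hx.1.le, rpow_two]
  · exact Measurable.aestronglyMeasurable (by fun_prop)
  · intro x hx
    simp only
    rw [mul_comm, rpow_mul (by linarith [hx.2]), rpow_two]

/-! ### Membership in H¹₀ and the algebraic equation -/

namespace IsPositiveSolution

variable {β c : ℝ} {ψ : ℝ → ℝ}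

theorem differentiableAt_reflect (h : IsPositiveSolution β c ψ) (hβ : π < β) {θ : ℝ}
    (hθ : θ ∈ Ioo 0 β) : DifferentiableAt ℝ (reflect β ψ) θ := by
  have hp := pi_pos
  have left : ∀ t ∈ Ioo 0 (β / 2), DifferentiableAt ℝ (reflect β ψ) t := fun t ht => by
    refine (h.differentiableAt t ht).congr_of_eventuallyEq ?_
    filter_upwards [Iio_mem_nhds ht.2] with s hs using reflect_of_le ψ (le_of_lt hs)
  have hsymm : (fun t => reflect β ψ (β - t)) = reflect β ψ := funext (reflect_sub β ψ)
  rcases lt_trichotomy θ (β / 2) with hlt | rfl | hlt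
  · exact left θ ⟨hθ.1, hlt⟩
  · have e : β - β / 2 = β / 2 := by ring
    have h1 : HasDerivWithinAt (reflect β ψ) 0 (Iic (β / 2)) (β / 2) := by
      refine (h.right_bc.mono_of_mem_nhdsWithin (Icc_mem_nhdsLE (by linarith))).congr
        (fun t ht => reflect_of_le ψ ht) (reflect_of_le ψ le_rfl)
    have h2 : HasDerivWithinAt (reflect β ψ) 0 (Ici (β / 2)) (β / 2) := by
      have hs : HasDerivWithinAt (fun t => β - t) (-1) (Ici (β / 2)) (β / 2) :=
        ((hasDerivAt_id (β / 2)).const_sub β).hasDerivWithinAt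
      have h1' : HasDerivWithinAt (reflect β ψ) 0 (Iic (β / 2)) (β - β / 2) := by rwa [e]
      have := h1'.comp (β / 2) hs (fun t (ht : β / 2 ≤ t) => show β - t ≤ β / 2 by linarith)
      rw [zero_mul] at this
      simpa only [Function.comp_def, hsymm] using this
    have h3 := h1.union h2
    rw [Iic_union_Ici, hasDerivWithinAt_univ] at h3
    exact h3.differentiableAt
  · rw [← hsymm]
    exact (left (β - θ) ⟨by linarith [hθ.2], by linarith⟩).comp θ (by fun_prop)

theorem deriv_reflect_sub (β : ℝ) (ψ : ℝ → ℝ) (θ : ℝ) :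
    deriv (reflect β ψ) (β - θ) = -deriv (reflect β ψ) θ := by
  have hsymm : (fun t => reflect β ψ (β - t)) = reflect β ψ := funext (reflect_sub β ψ)
  have := deriv_comp_const_sub (f := reflect β ψ) β θ
  rw [hsymm] at this
  linarith

theorem deriv_reflect_of_lt {θ : ℝ} (hθ : θ < β / 2) : deriv (reflect β ψ) θ = deriv ψ θ := by
  refine Filter.EventuallyEq.deriv_eq ?_
  filter_upwards [Iio_mem_nhds hθ] with s hs using reflect_of_le ψ (le_of_lt hs)

theorem continuousOn_reflect (h : IsPositiveSolution β c ψ) (hβ : π < β) :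
    ContinuousOn (reflect β ψ) (Icc 0 β) := by
  have hp := pi_pos
  have h1 : ContinuousOn (reflect β ψ) (Icc 0 (β / 2)) :=
    h.continuousOn.congr fun t ht => reflect_of_le ψ ht.2
  have h2 : ContinuousOn (reflect β ψ) (Icc (β / 2) β) := by
    have : ContinuousOn (fun t => reflect β ψ (β - t)) (Icc (β / 2) β) :=
      h1.comp (by fun_prop) fun t ht => ⟨by linarith [ht.2], by linarith [ht.1]⟩
    exact this.congr fun t _ => (reflect_sub β ψ t).symm
  have := h1.union_of_isClosed h2 isClosed_Icc isClosed_Icc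
  rwa [Icc_union_Icc_eq_Icc (by linarith) (by linarith)] at this

/-- As ψ' is positive and decreasing, it is bounded away from 0; only the singularity at 0 matters,
and θ^r is square integrable there for r > -1/2. -/
theorem memH10_reflect (h : IsPositiveSolution β c ψ) (hβ : π < β) (hc : 0 < c) {C r : ℝ}
    (hC : 0 ≤ C) (hr : -(1 / 2) < r) (hle : ∀ θ ∈ Ioo (0 : ℝ) 1, deriv ψ θ ≤ C * θ ^ r) :
    MemH10 0 β (reflect β ψ) := by
  have hp := pi_gt_three
  have hcont := h.continuousOn_reflect hβ
  have h0 : reflect β ψ 0 = 0 := by rw [reflect_of_le ψ (by linarith), h.left_bc]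
  have hβ0 : reflect β ψ β = 0 := by
    rw [← reflect_sub, sub_self, h0]
  have hmeas : AEStronglyMeasurable (reflect β ψ) (volume.restrict (Ioo 0 β)) :=
    (hcont.mono Ioo_subset_Icc_self).aestronglyMeasurable measurableSet_Ioo
  have hL2 : MemLp (deriv (reflect β ψ)) 2 (volume.restrict (Ioo 0 β)) := by
    set M := deriv ψ (1 / 2)
    have hhalf : (1 / 2 : ℝ) ∈ Ioo 0 (β / 2) := ⟨by norm_num, by linarith⟩
    have hM : 0 < M := h.deriv_pos hβ hc hhalf
    have left : ∀ t ∈ Ioo 0 (β / 2), |deriv (reflect β ψ) t| ≤ C * t ^ r + M := by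
      intro t ht
      rw [deriv_reflect_of_lt ht.2, abs_of_pos (h.deriv_pos hβ hc ht)]
      rcases lt_or_ge t 1 with h1 | h1
      · linarith [hle t ⟨ht.1, h1⟩]
      · have h2 := (h.strictAntiOn_deriv hβ hc hhalf ht (by linarith)).le
        have : 0 ≤ C * t ^ r := mul_nonneg hC (rpow_nonneg ht.1.le r)
        linarith
    have hb := memLp_rpow (b := β) (by linarith) hr
    have hmaj : MemLp (fun t => (C * t ^ r + C * (β - t) ^ r) + M) 2
        (volume.restrict (Ioo 0 β)) :=
      ((hb.1.const_mul C).add (hb.2.const_mul C)).add (memLp_const M)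
    refine hmaj.mono' (measurable_deriv _).aestronglyMeasurable
      (ae_restrict_of_forall_mem measurableSet_Ioo fun t ht => ?_)
    rw [Real.norm_eq_abs]
    have n1 : 0 ≤ C * t ^ r := mul_nonneg hC (rpow_nonneg ht.1.le r)
    have n2 : 0 ≤ C * (β - t) ^ r := mul_nonneg hC (rpow_nonneg (by linarith [ht.2]) r)
    rcases lt_trichotomy t (β / 2) with hlt | hlt | hlt
    · linarith [left t ⟨ht.1, hlt⟩]
    · have := deriv_reflect_sub β ψ t
      rw [show β - t = t by rw [hlt]; ring] at this
      rw [show deriv (reflect β ψ) t = 0 by linarith, abs_zero]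
      linarith
    · have h1 := left (β - t) ⟨by linarith [ht.2], by linarith⟩
      rw [deriv_reflect_sub, abs_neg] at h1
      linarith
  refine ⟨hcont, h0, hβ0, ?_, deriv (reflect β ψ), hL2, ?_⟩
  · rw [memLp_two_iff_integrable_sq hmeas]
    exact ((hcont.pow 2).integrableOn_Icc).mono_set Ioo_subset_Icc_self
  · refine hasWeakDerivOn_of_hasDerivAt
      (fun x hx => (h.differentiableAt_reflect hβ hx).hasDerivAt) ?_
    exact IntegrableOn.locallyIntegrableOn (hL2.integrable one_le_two)

/-- Test functions on (0, 1) are test functions on (0, β), so by uniqueness of weak derivatives g =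
ψ' almost everywhere on (0, 1). -/
theorem memLp_deriv (h : IsPositiveSolution β c ψ) (hβ : π < β)
    (hH : MemH10 0 β (reflect β ψ)) : MemLp (deriv ψ) 2 (volume.restrict (Ioo 0 1)) := by
  have hp := pi_gt_three
  obtain ⟨-, -, -, -, g, hg, hw⟩ := hH
  have hsub : Ioo (0 : ℝ) 1 ⊆ Ioo 0 β := Ioo_subset_Ioo_right (by linarith)
  have hg1 : MemLp g 2 (volume.restrict (Ioo 0 1)) :=
    hg.mono_measure (Measure.restrict_mono_set volume hsub)
  have hmem : ∀ θ ∈ Ioo (0 : ℝ) 1, θ ∈ Ioo 0 (β / 2) := fun θ hθ => ⟨hθ.1, by linarith [hθ.2]⟩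
  have hw1 : HasWeakDerivOn 0 1 ψ g := by
    intro φ hφ hc hU
    have h1 := hw φ hφ hc (hU.trans hsub)
    have hU' : tsupport (deriv φ) ⊆ Ioo 0 1 := tsupport_deriv_subset.trans hU
    rw [setIntegral_mul_eq (hU'.trans hsub), setIntegral_mul_eq (hU.trans hsub)] at h1
    rw [setIntegral_mul_eq hU, ← h1, ← setIntegral_mul_eq hU']
    refine setIntegral_congr_fun measurableSet_Ioo fun t ht => ?_
    simp only [reflect_of_le ψ (hmem t ht).2.le]
  have hi : LocallyIntegrableOn (deriv ψ) (Ioo 0 1) := ContinuousOn.locallyIntegrableOn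
    (fun θ hθ => (h.ode θ (hmem θ hθ)).continuousAt.continuousWithinAt) measurableSet_Ioo
  have hw2 := hasWeakDerivOn_of_hasDerivAt (fun θ hθ => h.hasDerivAt (hmem θ hθ)) hi
  exact (memLp_congr_ae (hw1.ae_eq hw2
    (IntegrableOn.locallyIntegrableOn (hg1.integrable one_le_two)) hi)).1 hg1

/-- A solution with square integrable derivative is `o(√θ)`. -/
theorem not_mul_sqrt_le (h : IsPositiveSolution β c ψ) (hβ : π < β)
    (hL : MemLp (deriv ψ) 2 (volume.restrict (Ioo 0 1))) {k : ℝ} (hk : 0 < k) :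
    ¬ ∀ θ ∈ Ioo (0 : ℝ) 1, k * √θ ≤ ψ θ := by
  intro hle
  have hp := pi_gt_three
  have hsq : IntegrableOn (fun t => deriv ψ t ^ 2) (Ioo 0 1) :=
    (memLp_two_iff_integrable_sq hL.1).1 hL
  have h1 : IntegrableOn (deriv ψ) (Ioo 0 1) := hL.integrable one_le_two
  have hprim : ContinuousOn (fun x => ∫ t in (0 : ℝ)..x, deriv ψ t ^ 2) (uIcc 0 1) := by
    refine intervalIntegral.continuousOn_primitive_interval ?_
    rw [uIcc_of_le zero_le_one]
    exact (integrableOn_Icc_iff_integrableOn_Ioo (by simp) (by simp)).2 hsq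
  have hlow : ∀ θ ∈ Ioo (0 : ℝ) 1, k ^ 2 ≤ ∫ t in (0 : ℝ)..θ, deriv ψ t ^ 2 := by
    intro θ hθ
    have hsub : Ioo 0 θ ⊆ Ioo (0 : ℝ) 1 := Ioo_subset_Ioo_right hθ.2.le
    have i1 : IntervalIntegrable (deriv ψ) volume 0 θ :=
      (intervalIntegrable_iff_integrableOn_Ioo_of_le hθ.1.le).2 (h1.mono_set hsub)
    have i2 : IntervalIntegrable (fun t => deriv ψ t ^ 2) volume 0 θ :=
      (intervalIntegrable_iff_integrableOn_Ioo_of_le hθ.1.le).2 (hsq.mono_set hsub)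
    have hs : 0 < √θ := sqrt_pos.2 hθ.1
    have hs2 : √θ * √θ = θ := mul_self_sqrt hθ.1.le
    have ftc := intervalIntegral.integral_eq_sub_of_hasDerivAt_of_le hθ.1.le
      (h.continuousOn.mono (Icc_subset_Icc_right (by linarith [hθ.2])))
      (fun x hx => h.hasDerivAt ⟨hx.1, by linarith [hx.2, hθ.2]⟩) i1
    rw [h.left_bc, sub_zero] at ftc
    -- Weighted AM-GM in place of Cauchy–Schwarz: ψ' ≤ k/(2√θ) + √θ ψ'²/(2k). Integrated, with ψ(θ)
    -- ≥ k√θ, it bounds the integral of ψ'² over (0, θ) below by k², yet that integral tends to 0.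
    have hmono := intervalIntegral.integral_mono_on hθ.1.le i1
      ((intervalIntegrable_const (c := k / (2 * √θ))).add (i2.const_mul (√θ / (2 * k))))
      (fun t _ => by
        have e : k / (2 * √θ) + √θ / (2 * k) * deriv ψ t ^ 2 - deriv ψ t =
            √θ / (2 * k) * (deriv ψ t - k / √θ) ^ 2 := by
          field_simp
          ring
        have : 0 ≤ √θ / (2 * k) * (deriv ψ t - k / √θ) ^ 2 := by positivity
        linarith)
    rw [intervalIntegral.integral_add intervalIntegrable_const (i2.const_mul _),
      intervalIntegral.integral_const_mul, intervalIntegral.integral_const, ftc, sub_zero,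
      smul_eq_mul] at hmono
    have h3 := hle θ hθ
    have e2 : θ * (k / (2 * √θ)) = k * √θ / 2 := by
      rw [mul_div_assoc', div_eq_div_iff (by positivity) (by norm_num)]
      linear_combination -2 * k * hs2
    rw [e2] at hmono
    set I := ∫ t in (0 : ℝ)..θ, deriv ψ t ^ 2
    have h4 : k * √θ / 2 ≤ √θ / (2 * k) * I := by linarith
    have h5 : √θ / (2 * k) * I = √θ * I / (2 * k) := by ring
    rw [h5, div_le_div_iff₀ (by norm_num) (by positivity)] at h4
    nlinarith
  have ht : Tendsto (fun x => ∫ t in (0 : ℝ)..x, deriv ψ t ^ 2) (𝓝[>] 0) (𝓝 0) := by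
    have := (hprim 0 (by simp)).tendsto
    rw [intervalIntegral.integral_same, uIcc_of_le zero_le_one] at this
    exact this.mono_left (nhdsWithin_le_of_mem (Icc_mem_nhdsGT one_pos))
  have : k ^ 2 ≤ 0 := by
    refine ge_of_tendsto ht ?_
    filter_upwards [Ioo_mem_nhdsGT one_pos] with θ hθ using hlow θ hθ
  nlinarith [pow_pos hk 2]

/-- The Wronskian of ψ and `regSol` is constant on (0, π/2], and either sign contradicts the
behaviour at 0. So it vanishes and ψ inherits the slope of `regSol`. -/
theorem deriv_pi_div_two_of_memH10 (h : IsPositiveSolution β c ψ) (hβ : π < β) (hc : 0 < c)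
    (hH : MemH10 0 β (reflect β ψ)) :
    deriv ψ (π / 2) = gammaQuot (alpha c) * ψ (π / 2) := by
  have hp := pi_gt_three
  obtain ⟨ha, ha1, hac⟩ := alpha_spec hc (h.le_quarter hβ)
  set a := alpha c
  have hmid : π / 2 ∈ Ioo 0 (β / 2) := ⟨by linarith, by linarith⟩
  have hmem : ∀ θ ∈ Ioo (0 : ℝ) 1, θ ∈ Ioo 0 (β / 2) := fun θ hθ => ⟨hθ.1, by linarith [hθ.2]⟩
  have hpi : ∀ t ∈ Ioc 0 (π / 2), t ∈ Ioo 0 π := fun t ht => ⟨ht.1, by linarith [ht.2]⟩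
  set W : ℝ → ℝ := fun t => deriv ψ t * regSol a t - ψ t * regSolDeriv a t with hW
  have hWd : ∀ t ∈ Ioc 0 (π / 2), HasDerivAt W 0 t := by
    intro t ht
    refine (h.hasDerivAt_wronskian (d := c) ⟨ht.1, by linarith [ht.2]⟩
      (hasDerivAt_regSol ha (hpi t ht)) ((hasDerivAt_regSolDeriv ha (hpi t ht)).congr_deriv ?_)
      ).congr_deriv (by ring)
    rw [V_of_le hβ ht.2, hac]
  have hWc : ∀ t ∈ Ioc 0 (π / 2), W t = W (π / 2) := by
    intro t ht
    have := (convex_Ioc 0 (π / 2)).norm_image_sub_le_of_norm_hasDerivWithin_le (f := W)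
      (f' := fun _ => 0) (C := 0) (fun x hx => (hWd x hx).hasDerivWithinAt) (by simp)
      (⟨by linarith, le_rfl⟩ : π / 2 ∈ Ioc 0 (π / 2)) ht
    simpa [sub_eq_zero] using this
  have h01 : ∀ t ∈ Ioo (0 : ℝ) 1, t ∈ Ioc 0 (π / 2) := fun t ht => ⟨ht.1, by linarith [ht.2]⟩
  set H := hyp a (1 / 2)
  have hH0 : 0 < H := hyp_pos ha (by norm_num) (by norm_num)
  have hbound : ∀ t ∈ Ioo (0 : ℝ) 1, regSol a t ≤ H * √t :=
    fun t ht => regSol_le_mul_sqrt ha ha1.le ht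
  have hW0 : W (π / 2) = 0 := by
    rcases lt_trichotomy (W (π / 2)) 0 with hneg | h0 | hpos
    -- If W < 0, then -W ≤ ψ · `regSolDeriv` ≤ 2Hψ/√t, so ψ is at least a multiple of √t.
    · exfalso
      refine h.not_mul_sqrt_le hβ (h.memLp_deriv hβ hH)
        (k := -W (π / 2) / (2 * H)) (div_pos (by linarith) (by positivity)) fun t ht => ?_
      have h1 := hWc t (h01 t ht)
      have h2 := regSol_pos ha (hpi t (h01 t ht))
      have h3 := regSolDeriv_le ha ha1.le ht.1 ht.2.le
      have h5 := h.pos t (hmem t ht)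
      have h6 := mul_pos (h.deriv_pos hβ hc (hmem t ht)) h2
      have h7 := hbound t ht
      have hs : 0 < √t := sqrt_pos.2 ht.1
      have hs2 : √t * √t = t := mul_self_sqrt ht.1.le
      have h8 : regSolDeriv a t ≤ 2 * H / √t := by
        refine h3.trans ?_
        rw [div_le_div_iff₀ ht.1 hs]
        nlinarith
      have h9 : -W (π / 2) ≤ ψ t * (2 * H / √t) := by
        have := mul_le_mul_of_nonneg_left h8 h5.le
        simp only [hW] at h1 ⊢
        linarith
      rw [mul_div_assoc', le_div_iff₀ hs] at h9
      rw [div_mul_eq_mul_div, div_le_iff₀ (by positivity)]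
      exact h9
    · exact h0
    -- If W > 0, the quotient ψ/`regSol` has derivative W/`regSol`² ≥ W/(H²t).
    · exfalso
      refine false_of_div_le_deriv (q := fun t => ψ t / regSol a t)
        (q' := fun t => W t / regSol a t ^ 2) (k := W (π / 2) / H ^ 2) (by positivity)
        (fun t ht => ?_) (fun t ht => ?_) fun t ht => ?_
      · exact (div_pos (h.pos t (hmem t ht)) (regSol_pos ha (hpi t (h01 t ht)))).le
      · exact (h.hasDerivAt (hmem t ht)).div (hasDerivAt_regSol ha (hpi t (h01 t ht)))
          (regSol_pos ha (hpi t (h01 t ht))).ne'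
      · rw [hWc t (h01 t ht), div_div]
        have h2 := regSol_pos ha (hpi t (h01 t ht))
        have h3 : regSol a t ^ 2 ≤ H ^ 2 * t := by
          calc _ ≤ (H * √t) ^ 2 := by gcongr; exact hbound t ht
            _ = _ := by rw [mul_pow, sq_sqrt ht.1.le]
        gcongr
  have hU := regSol_pos ha (hpi (π / 2) ⟨by linarith, le_rfl⟩)
  simp only [hW] at hW0
  rw [regSolDeriv_pi_div_two ha, regSlope_eq_gammaQuot ha] at hW0
  refine mul_right_cancel₀ hU.ne' ?_
  linarith

theorem solvesAlg_of_memH10 (h : IsPositiveSolution β c ψ) (hβ : π < β) (hc : 0 < c)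
    (hH : MemH10 0 β (reflect β ψ)) : SolvesAlg β c := by
  have hp := pi_pos
  obtain ⟨h1, h2⟩ := h.deriv_pi_div_two hβ hc
  rw [h.deriv_pi_div_two_of_memH10 hβ hc hH] at h2
  have h3 := h.pos (π / 2) ⟨by linarith, by linarith⟩
  refine ⟨⟨hc, h.le_quarter hβ, ?_⟩, h1⟩
  rw [← gammaQuot_alpha]
  exact (mul_right_cancel₀ h3.ne' h2).symm

end IsPositiveSolution

/-! ### Solvability of the algebraic equation and conclusion -/

/-- Since `√` is 0 on negative numbers, α(s²) stays at 1/2 for |s| > 1/2, and continuity holds on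
the whole line. -/
theorem continuous_gammaQuot_alpha_sq : Continuous fun s : ℝ => gammaQuot (alpha (s ^ 2)) := by
  have hG : ∀ f : ℝ → ℝ, Continuous f → (∀ s, 0 < f s) → Continuous fun s => Gamma (f s) := by
    intro f hf hp
    refine continuous_iff_continuousAt.2 fun s => ?_
    have hd : DifferentiableAt ℝ Gamma (f s) := differentiableAt_Gamma fun m => by
      have := hp s
      have := m.cast_nonneg (α := ℝ)
      linarith
    exact ContinuousAt.comp (f := f) hd.continuousAt hf.continuousAt
  have ha : Continuous fun s : ℝ => alpha (s ^ 2) := by unfold alpha; fun_prop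
  have hpos : ∀ s : ℝ, 0 < alpha (s ^ 2) := fun s => by
    unfold alpha
    linarith [sqrt_nonneg (1 - 4 * s ^ 2)]
  unfold gammaQuot
  refine continuous_const.mul (((hG _ (by fun_prop) fun s => ?_).div (hG _ (by fun_prop) fun s => ?_)
    fun s => (Gamma_pos_of_pos ?_).ne').pow 2)
  all_goals have := hpos s; linarith

theorem lt_half_mul_tan {β : ℝ} (hβ : betaCr < β) (h : (β - π) / 4 < π / 2) :
    gammaQuot (1 / 2) < 1 / 2 * tan ((β - π) / 4) := by
  have hp := pi_pos
  have h1 := betaCr_mem.1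
  have h3 : tan ((betaCr - π) / 4) < tan ((β - π) / 4) :=
    strictMonoOn_tan ⟨by linarith, by linarith⟩ ⟨by linarith, h⟩ (by linarith)
  rw [betaCr_spec.2.1] at h3
  rw [gammaQuot_half]
  linarith

theorem lt_quarter_of_solvesAlg {β c : ℝ} (hβ : betaCr < β) (h : SolvesAlg β c) : c < 1 / 4 := by
  obtain ⟨⟨_, h1, h2⟩, h3⟩ := h
  refine h1.lt_of_ne ?_
  rintro rfl
  rw [← gammaQuot_alpha, alpha_quarter] at h2
  rw [sqrt_quarter, show 1 / 2 * ((β - π) / 2) = (β - π) / 4 by ring] at h2 h3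
  exact (lt_half_mul_tan hβ h3).ne' h2

theorem exists_solvesAlg {β : ℝ} (hβ : betaCr < β) : ∃ c, SolvesAlg β c := by
  have hp := pi_pos
  have hB : 0 < (β - π) / 2 := by linarith [betaCr_mem.1]
  set B := (β - π) / 2 with hBdef
  -- s ≤ 1/2 means c = s² ≤ 1/4, and s < π/(2B) is the principal branch. Multiplying the equation by
  -- the cosine removes the pole at the end of the branch, so F is continuous up to m.
  set m := min (1 / 2) (π / (2 * B)) with hm
  have hm0 : 0 < m := lt_min (by norm_num) (by positivity)
  set F : ℝ → ℝ := fun s => s * sin (s * B) - gammaQuot (alpha (s ^ 2)) * cos (s * B) with hF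
  have hFc : Continuous F := by
    have := continuous_gammaQuot_alpha_sq
    fun_prop
  have hF0 : F 0 < 0 := by
    have h1 : 0 < alpha ((0 : ℝ) ^ 2) := by
      unfold alpha
      linarith [sqrt_nonneg (1 - 4 * (0 : ℝ) ^ 2)]
    have := (gammaQuot_spec h1).1
    simp only [hF, zero_mul, cos_zero, mul_one]
    linarith
  have hFm : 0 < F m := by
    rcases lt_or_ge (1 / 2) (π / (2 * B)) with h | h
    · have hme : m = 1 / 2 := min_eq_left h.le
      rw [lt_div_iff₀ (by positivity)] at h
      have hB4 : 1 / 2 * B = (β - π) / 4 := by rw [hBdef]; ring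
      have hlt : (β - π) / 4 < π / 2 := by linarith
      have hcos : 0 < cos ((β - π) / 4) := cos_pos_of_mem_Ioo ⟨by linarith, hlt⟩
      have h1 := lt_half_mul_tan hβ hlt
      rw [tan_eq_sin_div_cos, mul_div_assoc', lt_div_iff₀ hcos] at h1
      simp only [hF]
      rw [hme, hB4, show ((1 : ℝ) / 2) ^ 2 = 1 / 4 by norm_num, alpha_quarter]
      linarith
    · have hme : m = π / (2 * B) := min_eq_right h
      have : m * B = π / 2 := by rw [hme]; field_simp
      simp only [hF]
      rw [this, sin_pi_div_two, cos_pi_div_two]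
      linarith
  obtain ⟨s, hs, hs0⟩ := intermediate_value_Ioo hm0.le hFc.continuousOn ⟨hF0, hFm⟩
  have hs1 : s < 1 / 2 := hs.2.trans_le (min_le_left _ _)
  have hs2 : s < π / (2 * B) := hs.2.trans_le (min_le_right _ _)
  rw [lt_div_iff₀ (by positivity)] at hs2
  have hsqrt : √(s ^ 2) = s := sqrt_sq hs.1.le
  have hlt : s * B < π / 2 := by linarith
  have hcos : 0 < cos (s * B) := cos_pos_of_mem_Ioo ⟨by nlinarith [hs.1], hlt⟩
  refine ⟨s ^ 2, ⟨pow_pos hs.1 2, by nlinarith [hs.1], ?_⟩, by rwa [hsqrt]⟩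
  rw [← gammaQuot_alpha, hsqrt, tan_eq_sin_div_cos, mul_div_assoc', div_eq_iff hcos.ne']
  simp only [hF] at hs0
  linarith

theorem psi_sq_le {β c : ℝ} (h0 : 0 < c) (h1 : c ≤ 1 / 4) :
    ∃ C : ℝ, ∀ θ ∈ Ioo (0 : ℝ) 1, psi β c θ ^ 2 ≤ C * θ := by
  have hp := pi_gt_three
  obtain ⟨ha, ha1, -⟩ := alpha_spec h0 h1
  refine ⟨(cos (√c * ((β - π) / 2)) / regSol (alpha c) (π / 2) * hyp (alpha c) (1 / 2)) ^ 2,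
    fun θ hθ => ?_⟩
  have h2 := regSol_le_mul_sqrt ha ha1.le hθ
  have h3 := regSol_pos ha (⟨hθ.1, by linarith [hθ.2]⟩ : θ ∈ Ioo 0 π)
  have h4 : regSol (alpha c) θ ^ 2 ≤ hyp (alpha c) (1 / 2) ^ 2 * θ := by
    calc _ ≤ (hyp (alpha c) (1 / 2) * √θ) ^ 2 := by gcongr
      _ = _ := by rw [mul_pow, sq_sqrt hθ.1.le]
  rw [psi_of_le (by linarith [hθ.2]), mul_pow, mul_pow, mul_assoc]
  gcongr

/-- For β > β_cr the root satisfies c < 1/4, so α > 1/2 and ψ' = O(θ^(α-1)) has exponent above -1/2.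
-/
theorem memH10_reflect_psi {β c : ℝ} (hβ : betaCr < β) (h : SolvesAlg β c) :
    MemH10 0 β (reflect β (psi β c)) := by
  have hp := pi_gt_three
  have hβ' := betaCr_mem.1.trans hβ
  have hsol := isPositiveSolution_psi hβ' h
  have hlt := lt_quarter_of_solvesAlg hβ h
  have hcos := (mul_sin_of_solvesAlg hβ' h).1
  have h0 := h.1.1
  obtain ⟨ha, ha1, hac⟩ := alpha_spec h0 hlt.le
  have hah : 1 / 2 < alpha c := by
    refine ha.lt_of_ne fun he => ?_
    rw [← he] at hac
    linarith
  have hU := regSol_pos ha (⟨by linarith, by linarith⟩ : π / 2 ∈ Ioo 0 π)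
  set A := cos (√c * ((β - π) / 2)) / regSol (alpha c) (π / 2) with hA
  have hA0 : 0 < A := div_pos hcos hU
  have hH0 : 0 < hyp (alpha c) (1 / 2) := hyp_pos ha (by norm_num) (by norm_num)
  refine hsol.memH10_reflect hβ' h0 (C := A * (2 * hyp (alpha c) (1 / 2))) (r := alpha c - 1)
    (by positivity) (by linarith) fun θ hθ => ?_
  have hev : psi β c =ᶠ[𝓝 θ] fun t => A * regSol (alpha c) t := by
    filter_upwards [Iio_mem_nhds hθ.2] with t ht
    exact psi_of_le (by linarith [show t < 1 from ht])
  have hθπ : θ ∈ Ioo 0 π := ⟨hθ.1, by linarith [hθ.2]⟩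
  rw [hev.deriv_eq, ((hasDerivAt_regSol ha hθπ).const_mul A).deriv, mul_assoc]
  refine mul_le_mul_of_nonneg_left ((regSolDeriv_le ha ha1.le hθ.1 hθ.2.le).trans ?_) hA0.le
  have h2 := regSol_le ha ha1.le hθ.1 (by linarith [hθ.2])
  rw [rpow_sub_one hθ.1.ne', mul_div_assoc', mul_assoc]
  have hθ0 := hθ.1
  gcongr

theorem isGreatest_of_solvesAlg {β c : ℝ} (hβ : π < β) (h : SolvesAlg β c) :
    IsGreatest {c' : ℝ | 0 < c' ∧ ∃ ψ : ℝ → ℝ, IsPositiveSolution β c' ψ} c := by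
  have hsol := isPositiveSolution_psi hβ h
  obtain ⟨C, hC⟩ := psi_sq_le (β := β) h.1.1 h.1.2.1
  refine ⟨⟨h.1.1, _, hsol⟩, ?_⟩
  rintro d ⟨hd, χ, hχ⟩
  exact hsol.le_of_sq_le hβ h.1.1 hC hd hχ

end SectorHardy

theorem mainTheorem3 :
    (∀ β : ℝ, SectorHardy.betaCr < β →
      (∀ c : ℝ, 0 < c →
        ((∃ ψ : ℝ → ℝ, SectorHardy.IsPositiveSolution β c ψ ∧
            SectorHardy.MemH10 0 β (SectorHardy.reflect β ψ)) ↔ SectorHardy.SolvesAlg β c)) ∧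
      (∀ c : ℝ,
        IsGreatest {c' : ℝ | 0 < c' ∧ ∃ ψ : ℝ → ℝ, SectorHardy.IsPositiveSolution β c' ψ} c ↔
          SectorHardy.SolvesAlg β c) ∧
      (∀ c : ℝ, SectorHardy.SolvesAlg β c →
        SectorHardy.IsPositiveSolution β c (SectorHardy.psi β c) ∧
        SectorHardy.MemH10 0 β (SectorHardy.reflect β (SectorHardy.psi β c)) ∧
        ∀ ψ : ℝ → ℝ, SectorHardy.IsPositiveSolution β c ψ →
          ∃ k : ℝ, 0 < k ∧ ∀ θ ∈ Set.Icc 0 (β / 2), ψ θ = k * SectorHardy.psi β c θ)) ∧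
    (∀ β : ℝ, Real.pi < β → β ≤ SectorHardy.betaCr →
      IsGreatest {c : ℝ | 0 < c ∧ ∃ ψ : ℝ → ℝ, SectorHardy.IsPositiveSolution β c ψ} (1 / 4)) ∧
    (SectorHardy.IsPositiveSolution SectorHardy.betaCr (1 / 4) SectorHardy.psiCr ∧
      ∀ ψ : ℝ → ℝ, SectorHardy.IsPositiveSolution SectorHardy.betaCr (1 / 4) ψ →
        ∃ k : ℝ, 0 < k ∧
          ∀ θ ∈ Set.Icc 0 (SectorHardy.betaCr / 2), ψ θ = k * SectorHardy.psiCr θ) := by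
  refine ⟨fun β hβ => ?_, fun β hβ hcr => ?_, SectorHardy.isPositiveSolution_psiCr, fun ψ hψ => ?_⟩
  · have hβ' := SectorHardy.betaCr_mem.1.trans hβ
    refine ⟨fun c hc => ⟨?_, fun h => ?_⟩, fun c => ⟨fun h => ?_, fun h => ?_⟩, fun c h => ?_⟩
    · rintro ⟨ψ, hψ, hH⟩
      exact hψ.solvesAlg_of_memH10 hβ' hc hH
    · exact ⟨_, SectorHardy.isPositiveSolution_psi hβ' h, SectorHardy.memH10_reflect_psi hβ h⟩
    -- A greatest element is unique, so the existence of one root d of the algebraic equation gives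
    -- c = d.
    · obtain ⟨d, hd⟩ := SectorHardy.exists_solvesAlg hβ
      rwa [h.unique (SectorHardy.isGreatest_of_solvesAlg hβ' hd)]
    · exact SectorHardy.isGreatest_of_solvesAlg hβ' h
    · have hsol := SectorHardy.isPositiveSolution_psi hβ' h
      exact ⟨hsol, SectorHardy.memH10_reflect_psi hβ h,
        fun ψ hψ => hsol.eq_const_mul hβ' h.1.1 hψ⟩
  · refine ⟨⟨by norm_num, SectorHardy.exists_isPositiveSolution_quarter hβ hcr⟩, ?_⟩
    rintro c ⟨-, ψ, hψ⟩
    exact hψ.le_quarter hβ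
  · exact SectorHardy.isPositiveSolution_psiCr.eq_const_mul SectorHardy.betaCr_mem.1
      (by norm_num) hψ
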